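/- A knot diagram is an oriented smooth immersion of $S^1$ in $\mathbb R^2$ whose only multiple points are transversal double points, each decorated with over- /undercrossing information; parametrizations that differ by an orientation-preserving diffeomorphism of $S^1$ give the same diagram. The inverse of a diagram is the same diagram with the orientation of the strand reversed. Diagrams are transformed by orientation-preserving diffeomorphisms of the plane and by Reidemeister moves $\Omega_1,\Omega_2,\Omega_3$ inside disks of the plane (with all orientations of the strands, all choices of crossings and their mirror images). In the changing disk of an $\Omega_3$-move there are a top strand (crossing over the two others), a middle strand and a bottom strand (crossing under the two others); the move is called descending if, following the orientation of the knot, the three strands are passed in the cyclic order top, middle, bottom, and ascending otherwise. Theorem. Let $K$ be a figure eight knot diagram, that is, a plane knot diagram with exactly four crossings, alternating between over- and undercrossings along the knot, whose crossings are met along the knot in the cyclic order $1\,2\,3\,1\,4\,3\,2\,4$. Then any finite sequence of Reidemeister moves and orientation-preserving diffeomorphisms of the plane that transforms $K$ into its inverse contains both an ascending and a descending $\Omega_3$-move. In particular, it contains at least two $\Omega_3$-moves. -/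

import Mathlib

open scoped ContDiff

namespace PlaneKnot

/-- The plane. -/
abbrev Plane : Type := ℝ × ℝ

/-- The determinant of two plane vectors. -/
def cross (v w : Plane) : ℝ := v.1 * w.2 - v.2 * w.1

/-- Two real parameters represent the same point of the circle `ℝ/ℤ`. -/
def SameParam (s t : ℝ) : Prop := ∃ n : ℤ, t = s + n

/-- The parameters `s`, `t` are different points of the circle with the same image under `γ`. -/
def Crosses (γ : ℝ → Plane) (s t : ℝ) : Prop := γ s = γ t ∧ ¬ SameParam s t

/-- An oriented knot diagram: a smooth immersion of the circle `ℝ/ℤ` in the plane (written as a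
`1`-periodic map, oriented by increasing parameter) whose only multiple points are transversal
double points, together with the set `overpass` of those parameters at which the strand is the
overpassing one at a double point. -/
structure KnotDiagram where
  γ : ℝ → Plane
  smooth : ContDiff ℝ ∞ γ
  periodic : ∀ t, γ (t + 1) = γ t
  immersed : ∀ t, deriv γ t ≠ 0
  transversal : ∀ s t, Crosses γ s t → cross (deriv γ s) (deriv γ t) ≠ 0
  no_triple : ∀ r s t, Crosses γ r s → Crosses γ s t → ¬ Crosses γ r t
  overpass : Set ℝ
  overpass_periodic : ∀ t, t + 1 ∈ overpass ↔ t ∈ overpass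
  overpass_crosses : ∀ s ∈ overpass, ∃ t, Crosses γ s t
  overpass_iff : ∀ s t, Crosses γ s t → (s ∈ overpass ↔ t ∉ overpass)

/-- Orientation-preserving diffeomorphisms of the circle `ℝ/ℤ`, lifted to `ℝ`. -/
def IsCircleDiffeo (σ : ℝ → ℝ) : Prop :=
  ContDiff ℝ ∞ σ ∧ (∀ t, σ (t + 1) = σ t + 1) ∧ ∀ t, 0 < deriv σ t

/-- Orientation-preserving diffeomorphisms of the plane. -/
def IsPlaneDiffeo (F : Plane → Plane) : Prop :=
  ContDiff ℝ ∞ F ∧ (∃ G : Plane → Plane, ContDiff ℝ ∞ G ∧ (∀ p, G (F p) = p) ∧ ∀ p, F (G p) = p) ∧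
    ∀ p, 0 < (fderiv ℝ F p).det

namespace KnotDiagram

/-- Two parametrizations give the same diagram: the same oriented image with the same
over-undercrossing information. -/
def Same (K L : KnotDiagram) : Prop :=
  ∃ σ : ℝ → ℝ, IsCircleDiffeo σ ∧
    ∀ t, L.γ t = K.γ (σ t) ∧ (t ∈ L.overpass ↔ σ t ∈ K.overpass)

/-- Equivalence of diagrams: an orientation-preserving diffeomorphism of the plane takes one
diagram to the other. -/
def Equivalent (K L : KnotDiagram) : Prop :=
  ∃ F : Plane → Plane, IsPlaneDiffeo F ∧ ∃ σ : ℝ → ℝ, IsCircleDiffeo σ ∧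
    ∀ t, L.γ t = F (K.γ (σ t)) ∧ (t ∈ L.overpass ↔ σ t ∈ K.overpass)

theorem crosses_neg {γ : ℝ → Plane} {s t : ℝ} :
    Crosses (fun x => γ (-x)) s t ↔ Crosses γ (-s) (-t) := by
  unfold Crosses SameParam
  refine and_congr Iff.rfl (not_congr ⟨?_, ?_⟩)
  · rintro ⟨n, hn⟩
    exact ⟨-n, by push_cast; linarith⟩
  · rintro ⟨n, hn⟩
    exact ⟨-n, by push_cast; linarith⟩

/-- The inverse diagram: the orientation of the strand is reversed. -/
def inverse (K : KnotDiagram) : KnotDiagram where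
  γ := fun t => K.γ (-t)
  smooth := K.smooth.comp contDiff_neg
  periodic := fun t => by
    have h := K.periodic (-(t + 1))
    rw [← h]
    congr 1
    ring
  immersed := fun t => by
    rw [deriv_comp_neg]
    exact neg_ne_zero.mpr (K.immersed (-t))
  transversal := fun s t h => by
    rw [deriv_comp_neg, deriv_comp_neg]
    have := K.transversal _ _ (crosses_neg.mp h)
    simpa [cross] using this
  no_triple := fun r s t h₁ h₂ h₃ =>
    K.no_triple _ _ _ (crosses_neg.mp h₁) (crosses_neg.mp h₂) (crosses_neg.mp h₃)
  overpass := {t | -t ∈ K.overpass}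
  overpass_periodic := fun t => by
    have h := K.overpass_periodic (-(t + 1))
    have e : -(t + 1) + 1 = -t := by ring
    rw [e] at h
    exact h.symm
  overpass_crosses := fun s hs => by
    obtain ⟨t, ht⟩ := K.overpass_crosses _ hs
    exact ⟨-t, crosses_neg.mpr (by rwa [neg_neg])⟩
  overpass_iff := fun s t h => K.overpass_iff _ _ (crosses_neg.mp h)

/-- A figure eight knot diagram: the alternating diagram with four crossings which are met along
the knot in the cyclic order `1 2 3 1 4 3 2 4`. -/
def IsFigureEight (K : KnotDiagram) : Prop :=
  ∃ t : Fin 8 → ℝ, StrictMono t ∧ t 7 < t 0 + 1 ∧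
    K.γ (t 0) = K.γ (t 3) ∧ K.γ (t 1) = K.γ (t 6) ∧
    K.γ (t 2) = K.γ (t 5) ∧ K.γ (t 4) = K.γ (t 7) ∧
    (∀ r s, Crosses K.γ r s → ∃ i, SameParam (t i) r) ∧
    ((∀ i, t i ∈ K.overpass ↔ Even (i : ℕ)) ∨ (∀ i, t i ∈ K.overpass ↔ Odd (i : ℕ)))

end KnotDiagram

/-! ### Reidemeister moves -/

/-- The closed unit disk. -/
def unitDisk : Set Plane := {p | p.1 ^ 2 + p.2 ^ 2 ≤ 1}

/-- The boundary of the unit disk. -/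
def unitCircle : Set Plane := {p | p.1 ^ 2 + p.2 ^ 2 = 1}

/-- `φ` restricts to a diffeomorphism of the unit disk onto its image (a smooth map on the closed
disk is the restriction of a smooth map of the plane). -/
def IsDiskEmbedding (φ : Plane → Plane) : Prop :=
  ContDiff ℝ ∞ φ ∧ Set.InjOn φ unitDisk ∧ ∀ p ∈ unitDisk, (fderiv ℝ φ p).det ≠ 0

/-- The parameter `t` lies, modulo `1`, in one of the arcs `[a i, b i]`. -/
def InArcs {n : ℕ} (a b : Fin n → ℝ) (t : ℝ) : Prop :=
  ∃ i, ∃ s ∈ Set.Icc (a i) (b i), SameParam s t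

/-- The arcs `[a i, b i]` embed in the circle and are pairwise disjoint there. -/
def ArcsDisjoint {n : ℕ} (a b : Fin n → ℝ) : Prop :=
  ∀ i j, ∀ s ∈ Set.Icc (a i) (b i), ∀ t ∈ Set.Icc (a j) (b j), SameParam s t → i = j ∧ s = t

/-- The part of the diagram `K` in the disk `φ(unitDisk)` is the image under `φ` of the strands
`m i`, `-1 ≤ u ≤ 1`. The strand `m i` is the image of the arc `[a i, b i]`, run through in either
direction, and the rest of the diagram lies outside the disk. -/
def HasPart {n : ℕ} (K : KnotDiagram) (φ : Plane → Plane) (m : Fin n → ℝ → Plane)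
    (a b : Fin n → ℝ) : Prop :=
  (∀ i, ∃ u : ℝ → ℝ,
    (StrictMonoOn u (Set.Icc (a i) (b i)) ∨ StrictAntiOn u (Set.Icc (a i) (b i))) ∧
    u '' Set.Icc (a i) (b i) = Set.Icc (-1) 1 ∧
    ∀ t ∈ Set.Icc (a i) (b i), K.γ t = φ (m i (u t))) ∧
  ∀ t, ¬ InArcs a b t → K.γ t ∉ φ '' unitDisk

/-- The strands are layered: `ord 0` is the top strand, `ord 1` the next one, and so on. -/
def Layered {n : ℕ} (K : KnotDiagram) (ord : Equiv.Perm (Fin n)) (a b : Fin n → ℝ) : Prop :=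
  ∀ p q, p < q → ∀ s ∈ Set.Icc (a (ord p)) (b (ord p)), ∀ t ∈ Set.Icc (a (ord q)) (b (ord q)),
    K.γ s = K.γ t → s ∈ K.overpass

/-- `L` arises from `K` by replacing the part `m` inside a disk by the part `m'`; the
identifications `φ`, `ψ` of the changing disk with the unit disk agree on the boundary, and
nothing changes outside the changing disk. -/
def Replaces {n : ℕ} (m m' : Fin n → ℝ → Plane) (ord : Equiv.Perm (Fin n)) (a b : Fin n → ℝ)
    (K L : KnotDiagram) : Prop :=
  ArcsDisjoint a b ∧
  ∃ φ ψ : Plane → Plane, IsDiskEmbedding φ ∧ IsDiskEmbedding ψ ∧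
    φ '' unitDisk = ψ '' unitDisk ∧ Set.EqOn φ ψ unitCircle ∧
    HasPart K φ m a b ∧ HasPart L ψ m' a b ∧ Layered K ord a b ∧ Layered L ord a b ∧
    ∀ t, ¬ InArcs a b t → K.γ t = L.γ t ∧ (t ∈ K.overpass ↔ t ∈ L.overpass)

/-- A move between diagrams that exchanges, in one of the two directions, the parts `m` and `m'`,
where the layering of the strands and their position on the circle satisfy `P`. -/
def Move {n : ℕ} (m m' : Fin n → ℝ → Plane) (P : Equiv.Perm (Fin n) → (Fin n → ℝ) → Prop)
    (K L : KnotDiagram) : Prop :=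
  ∃ K' L' : KnotDiagram, K.Same K' ∧ L.Same L' ∧ ∃ ord a b, P ord a ∧
    (Replaces m m' ord a b K' L' ∨ Replaces m m' ord a b L' K')

/-- A strand without crossings. -/
noncomputable def omega1Plain : Fin 1 → ℝ → Plane := ![fun u => (u, 0)]

/-- A strand with a kink, which crosses itself at `u = -1/2` and `u = 1/2`. -/
noncomputable def omega1Kink : Fin 1 → ℝ → Plane :=
  ![fun u => (u * (4 * u ^ 2 - 1) / 3, (1 - u ^ 2) / 2)]

/-- Two disjoint strands. -/
noncomputable def omega2Plain : Fin 2 → ℝ → Plane :=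
  ![fun u => (4 * u / 5, 3 / 5), fun u => (4 * u / 5, -(3 / 5))]

/-- Two strands that cross each other at `u = -1/2` and `u = 1/2`. -/
noncomputable def omega2Crossed : Fin 2 → ℝ → Plane :=
  ![fun u => (4 * u / 5, (4 * u ^ 2 - 1) / 5), fun u => (4 * u / 5, -((4 * u ^ 2 - 1) / 5))]

/-- Two strands that cross at the origin and a third strand passing above the origin. -/
noncomputable def omega3Upper : Fin 3 → ℝ → Plane :=
  ![fun u => (3 * u / 5, 4 * u / 5), fun u => (3 * u / 5, -(4 * u / 5)),
    fun u => (u, (1 - u ^ 2) / 2)]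

/-- Two strands that cross at the origin and a third strand passing below the origin. -/
noncomputable def omega3Lower : Fin 3 → ℝ → Plane :=
  ![fun u => (3 * u / 5, 4 * u / 5), fun u => (3 * u / 5, -(4 * u / 5)),
    fun u => (u, -((1 - u ^ 2) / 2))]

/-- The points `x`, `y`, `z` of the circle `ℝ/ℤ` are distinct and met in this cyclic order. -/
def InCyclicOrder (x y z : ℝ) : Prop :=
  ∃ p q : ℤ, x < y + p ∧ y + p < z + q ∧ z + q < x + 1

/-- The `Ω₁`-moves. -/
def Omega1 : KnotDiagram → KnotDiagram → Prop := Move omega1Plain omega1Kink fun _ _ => True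

/-- The `Ω₂`-moves. -/
def Omega2 : KnotDiagram → KnotDiagram → Prop := Move omega2Plain omega2Crossed fun _ _ => True

/-- The descending `Ω₃`-moves: the strands are passed in the cyclic order top, middle, bottom. -/
def Omega3Descending : KnotDiagram → KnotDiagram → Prop :=
  Move omega3Upper omega3Lower fun ord a => InCyclicOrder (a (ord 0)) (a (ord 1)) (a (ord 2))

/-- The ascending `Ω₃`-moves: all the others. -/
def Omega3Ascending : KnotDiagram → KnotDiagram → Prop :=
  Move omega3Upper omega3Lower fun ord a => ¬ InCyclicOrder (a (ord 0)) (a (ord 1)) (a (ord 2))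

/-- The kinds of steps by which a diagram is transformed. -/
inductive StepKind where
  | equivalence
  | omega1
  | omega2
  | omega3Ascending
  | omega3Descending

/-- `K` is transformed to `L` by a step of the given kind. -/
def Step : StepKind → KnotDiagram → KnotDiagram → Prop
  | .equivalence => KnotDiagram.Equivalent
  | .omega1 => Omega1
  | .omega2 => Omega2
  | .omega3Ascending => Omega3Ascending
  | .omega3Descending => Omega3Descending

/-- The diagrams `D 0, D 1, …, D n` form a sequence of transformations, the `i`-th of which is a
step of kind `kind i`. -/
def IsTransformation {n : ℕ} (D : Fin (n + 1) → KnotDiagram) (kind : Fin n → StepKind) : Prop :=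
  ∀ i : Fin n, Step (kind i) (D i.castSucc) (D i.succ)

end PlaneKnot

/-! ### A concrete figure eight diagram, showing that the notion is not void -/

namespace PlaneKnot

open Real in
/-- A closed curve with the shape of a figure eight knot diagram. -/
noncomputable def eightCurve (t : ℝ) : Plane :=
  ((2 + cos (4 * π * t)) * cos (6 * π * t), (2 + cos (4 * π * t)) * sin (6 * π * t))

open Real in
theorem eightCurve_eq_iff (s t : ℝ) : eightCurve s = eightCurve t ↔
    cos (4 * π * s) = cos (4 * π * t) ∧ cos (6 * π * s) = cos (6 * π * t) ∧
      sin (6 * π * s) = sin (6 * π * t) := by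
  constructor
  · intro h
    have h1 := congrArg Prod.fst h
    have h2 := congrArg Prod.snd h
    simp only [eightCurve] at h1 h2
    have ps := neg_one_le_cos (4 * π * s)
    have pt := neg_one_le_cos (4 * π * t)
    have e : (2 + cos (4 * π * s)) ^ 2 = (2 + cos (4 * π * t)) ^ 2 := by
      linear_combination ((2 + cos (4 * π * s)) * cos (6 * π * s) +
        (2 + cos (4 * π * t)) * cos (6 * π * t)) * h1 +
        ((2 + cos (4 * π * s)) * sin (6 * π * s) +
        (2 + cos (4 * π * t)) * sin (6 * π * t)) * h2 -
        (2 + cos (4 * π * s)) ^ 2 * sin_sq_add_cos_sq (6 * π * s) +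
        (2 + cos (4 * π * t)) ^ 2 * sin_sq_add_cos_sq (6 * π * t)
    have e' : cos (4 * π * s) = cos (4 * π * t) := by nlinarith
    rw [e'] at h1 h2
    have hne : 2 + cos (4 * π * t) ≠ 0 := by linarith
    exact ⟨e', mul_left_cancel₀ hne h1, mul_left_cancel₀ hne h2⟩
  · rintro ⟨h1, h2, h3⟩
    simp [eightCurve, h1, h2, h3]

open Real in
theorem eightCurve_crosses {s t : ℝ} (h : Crosses eightCurve s t) :
    ∃ k n : ℤ, 2 * (s + t) = k ∧ 3 * (s - t) = n ∧ ¬ (3 ∣ n) := by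
  obtain ⟨h, hne⟩ := h
  obtain ⟨h1, h2, h3⟩ := (eightCurve_eq_iff s t).mp h
  have hp := pi_pos.ne'
  have h4 : cos (6 * π * s - 6 * π * t) = 1 := by
    rw [cos_sub, h2, h3]
    nlinarith [sin_sq_add_cos_sq (6 * π * t)]
  obtain ⟨n, hn⟩ := (cos_eq_one_iff _).mp h4
  have hn' : 3 * (s - t) = n := by
    apply mul_left_cancel₀ (mul_ne_zero two_ne_zero hp)
    linear_combination -hn
  obtain ⟨k, hk | hk⟩ := cos_eq_cos_iff.mp h1
  · exfalso
    have hk' : 2 * (t - s) = k := by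
      apply mul_left_cancel₀ (mul_ne_zero two_ne_zero hp)
      linear_combination hk
    exact hne ⟨-n - k, by push_cast; linarith⟩
  · refine ⟨k, n, ?_, hn', ?_⟩
    · apply mul_left_cancel₀ (mul_ne_zero two_ne_zero hp)
      linear_combination hk
    · rintro ⟨c, rfl⟩
      exact hne ⟨-c, by push_cast at hn' ⊢; linarith⟩

open Real in
theorem eightCurve_of {s t : ℝ} (k n : ℤ) (hk : 2 * (s + t) = k) (hn : 3 * (s - t) = n) :
    eightCurve s = eightCurve t := by
  rw [eightCurve_eq_iff]
  refine ⟨cos_eq_cos_iff.mpr ⟨k, Or.inr ?_⟩, ?_, ?_⟩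
  · rw [← hk]; ring
  · rw [show 6 * π * s = 6 * π * t + n * (2 * π) by rw [← hn]; ring, cos_add_int_mul_two_pi]
  · rw [show 6 * π * s = 6 * π * t + n * (2 * π) by rw [← hn]; ring, sin_add_int_mul_two_pi]

open Real in
theorem eightCurve_hasDerivAt (t : ℝ) : HasDerivAt eightCurve
    (-(sin (4 * π * t) * (4 * π)) * cos (6 * π * t) +
        (2 + cos (4 * π * t)) * -(sin (6 * π * t) * (6 * π)),
      -(sin (4 * π * t) * (4 * π)) * sin (6 * π * t) +
        (2 + cos (4 * π * t)) * (cos (6 * π * t) * (6 * π))) t := by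
  have l (c : ℝ) : HasDerivAt (fun x : ℝ => c * x) c t := by
    simpa using (hasDerivAt_id t).const_mul c
  have r : HasDerivAt (fun x => 2 + cos (4 * π * x)) (-(sin (4 * π * t) * (4 * π))) t := by
    simpa using ((l (4 * π)).cos).const_add 2
  have c : HasDerivAt (fun x => cos (6 * π * x)) (-(sin (6 * π * t) * (6 * π))) t := by
    simpa using (l (6 * π)).cos
  exact (r.mul c).prodMk (r.mul (l (6 * π)).sin)

open Real in
/-- A diagram of the figure eight knot (as a closed braid with three strands). -/
noncomputable def eightDiagram : KnotDiagram where
  γ := eightCurve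
  smooth := by unfold eightCurve; fun_prop
  periodic := fun t => by
    unfold eightCurve
    rw [show 4 * π * (t + 1) = 4 * π * t + (2 : ℤ) * (2 * π) by push_cast; ring,
      show 6 * π * (t + 1) = 6 * π * t + (3 : ℤ) * (2 * π) by push_cast; ring,
      cos_add_int_mul_two_pi, cos_add_int_mul_two_pi, sin_add_int_mul_two_pi]
  immersed := fun t h => by
    rw [(eightCurve_hasDerivAt t).deriv] at h
    have h1 := congrArg Prod.fst h
    have h2 := congrArg Prod.snd h
    simp only [Prod.fst_zero, Prod.snd_zero] at h1 h2
    have e : (2 + cos (4 * π * t)) * (6 * π) = 0 := by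
      linear_combination -sin (6 * π * t) * h1 + cos (6 * π * t) * h2 -
        (2 + cos (4 * π * t)) * (6 * π) * sin_sq_add_cos_sq (6 * π * t)
    have := neg_one_le_cos (4 * π * t)
    have := pi_pos
    have : 0 < (2 + cos (4 * π * t)) * (6 * π) := mul_pos (by linarith) (by linarith)
    linarith
  transversal := fun s t hc => by
    obtain ⟨h1, h2, h3⟩ := (eightCurve_eq_iff s t).mp hc.1
    obtain ⟨k, n, hk, hn, h3n⟩ := eightCurve_crosses hc
    have hs : sin (4 * π * t) = - sin (4 * π * s) := by
      rw [show 4 * π * t = k * (2 * π) - 4 * π * s by rw [← hk]; ring, sin_int_mul_two_pi_sub]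
    rw [(eightCurve_hasDerivAt t).deriv, (eightCurve_hasDerivAt s).deriv, ← h1, ← h2, ← h3, hs]
    intro h0
    simp only [cross] at h0
    have e : sin (4 * π * s) * ((2 + cos (4 * π * s)) * (48 * π ^ 2)) = 0 := by
      linear_combination -h0 - (sin (4 * π * s) * ((2 + cos (4 * π * s)) * (48 * π ^ 2))) *
        sin_sq_add_cos_sq (6 * π * s)
    have := neg_one_le_cos (4 * π * s)
    have := pi_pos
    have p : 0 < (2 + cos (4 * π * s)) * (48 * π ^ 2) := mul_pos (by linarith) (by positivity)
    obtain h | h := mul_eq_zero.mp e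
    · obtain ⟨m, hm⟩ := sin_eq_zero_iff.mp h
      have hm' : 4 * s = m := by
        apply mul_left_cancel₀ pi_pos.ne'
        linear_combination -hm
      have : (3 * m : ℤ) = 3 * k + 2 * n := by
        have : (3 * m : ℝ) = 3 * k + 2 * n := by rw [← hm', ← hk, ← hn]; ring
        exact_mod_cast this
      omega
    · exact p.ne' h
  no_triple := fun r s t h₁ h₂ h₃ => by
    obtain ⟨k, n, hk, hn, h⟩ := eightCurve_crosses h₁
    obtain ⟨k', n', hk', hn', h'⟩ := eightCurve_crosses h₂
    obtain ⟨k'', n'', hk'', hn'', h''⟩ := eightCurve_crosses h₃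
    have e1 : 3 * k - 2 * n = 3 * k' + 2 * n' := by
      have : (3 * k - 2 * n : ℝ) = 3 * k' + 2 * n' := by rw [← hk, ← hn, ← hk', ← hn']; ring
      exact_mod_cast this
    have e2 : 3 * k + 2 * n = 3 * k'' + 2 * n'' := by
      have : (3 * k + 2 * n : ℝ) = 3 * k'' + 2 * n'' := by rw [← hk, ← hn, ← hk'', ← hn'']; ring
      exact_mod_cast this
    have e3 : 3 * k' - 2 * n' = 3 * k'' - 2 * n'' := by
      have : (3 * k' - 2 * n' : ℝ) = 3 * k'' - 2 * n'' := by
        rw [← hk', ← hn', ← hk'', ← hn'']; ring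
      exact_mod_cast this
    omega
  overpass := {t | ∃ j : ℤ, 12 * t = 3 * j + 1}
  overpass_periodic := fun t => by
    constructor
    · rintro ⟨j, hj⟩
      exact ⟨j - 4, by push_cast; linarith⟩
    · rintro ⟨j, hj⟩
      exact ⟨j + 4, by push_cast; linarith⟩
  overpass_crosses := by
    rintro s ⟨j, hj⟩
    refine ⟨s + 1 / 3, eightCurve_of (j + 1) (-1) (by push_cast; linarith) (by push_cast; ring), ?_⟩
    rintro ⟨n, hn⟩
    have : (1 : ℤ) = 3 * n := by
      have : (1 : ℝ) = 3 * n := by linarith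
      exact_mod_cast this
    omega
  overpass_iff := fun s t h => by
    obtain ⟨k, n, hk, hn, h⟩ := eightCurve_crosses h
    have es : 12 * s = ((3 * k + 2 * n : ℤ) : ℝ) := by push_cast; rw [← hk, ← hn]; ring
    have et : 12 * t = ((3 * k - 2 * n : ℤ) : ℝ) := by push_cast; rw [← hk, ← hn]; ring
    have hmem (x : ℝ) (c : ℤ) (hx : 12 * x = c) :
        (x ∈ {t : ℝ | ∃ j : ℤ, 12 * t = 3 * j + 1}) ↔ c % 3 = 1 := by
      change (∃ j : ℤ, 12 * x = 3 * j + 1) ↔ _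
      rw [hx]
      constructor
      · rintro ⟨j, hj⟩
        have : c = 3 * j + 1 := by exact_mod_cast hj
        omega
      · intro hc
        refine ⟨c / 3, ?_⟩
        have : c = 3 * (c / 3) + 1 := by omega
        exact_mod_cast this
    rw [hmem s _ es, hmem t _ et]
    omega

theorem eightDiagram_isFigureEight : eightDiagram.IsFigureEight := by
  refine ⟨![1 / 12, 2 / 12, 4 / 12, 5 / 12, 7 / 12, 8 / 12, 10 / 12, 11 / 12], ?_, ?_,
    eightCurve_of 1 (-1) ?_ ?_, eightCurve_of 2 (-2) ?_ ?_, eightCurve_of 2 (-1) ?_ ?_,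
    eightCurve_of 3 (-1) ?_ ?_, ?_, Or.inl ?_⟩
  · rw [Fin.strictMono_iff_lt_succ]
    intro i
    fin_cases i <;> simp <;> norm_num
  all_goals try (simp; norm_num; done)
  · intro r s h
    obtain ⟨k, n, hk, hn, h3⟩ := eightCurve_crosses h
    have er : 12 * r = ((3 * k + 2 * n : ℤ) : ℝ) := by push_cast; rw [← hk, ← hn]; ring
    have h0 : ¬ 3 ∣ (3 * k + 2 * n) := by omega
    generalize 3 * k + 2 * n = c at er h0
    have hc : c % 12 = 1 ∨ c % 12 = 2 ∨ c % 12 = 4 ∨ c % 12 = 5 ∨ c % 12 = 7 ∨ c % 12 = 8 ∨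
        c % 12 = 10 ∨ c % 12 = 11 := by omega
    have e : (c : ℝ) = 12 * (c / 12 : ℤ) + (c % 12 : ℤ) := by
      exact_mod_cast (Int.mul_ediv_add_emod c 12).symm
    rcases hc with hc | hc | hc | hc | hc | hc | hc | hc <;> rw [hc] at e
    · exact ⟨0, c / 12, by simp; push_cast at e; linarith⟩
    · exact ⟨1, c / 12, by simp; push_cast at e; linarith⟩
    · exact ⟨2, c / 12, by simp; push_cast at e; linarith⟩
    · exact ⟨3, c / 12, by simp; push_cast at e; linarith⟩
    · exact ⟨4, c / 12, by simp; push_cast at e; linarith⟩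
    · exact ⟨5, c / 12, by simp; push_cast at e; linarith⟩
    · exact ⟨6, c / 12, by simp; push_cast at e; linarith⟩
    · exact ⟨7, c / 12, by simp; push_cast at e; linarith⟩
  · have hmem (x : ℝ) (c : ℤ) (hx : 12 * x = c) : x ∈ eightDiagram.overpass ↔ c % 3 = 1 := by
      change (∃ j : ℤ, 12 * x = 3 * j + 1) ↔ _
      rw [hx]
      constructor
      · rintro ⟨j, hj⟩
        have : c = 3 * j + 1 := by exact_mod_cast hj
        omega
      · intro hc
        refine ⟨c / 3, ?_⟩
        have : c = 3 * (c / 3) + 1 := by omega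
        exact_mod_cast this
    intro i
    fin_cases i
    · rw [hmem _ 1 (by simp)]; decide
    · rw [hmem _ 2 (by simp; norm_num)]; decide
    · rw [hmem _ 4 (by simp; norm_num)]; decide
    · rw [hmem _ 5 (by simp; norm_num)]; decide
    · rw [hmem _ 7 (by simp; norm_num)]; decide
    · rw [hmem _ 8 (by simp; norm_num)]; decide
    · rw [hmem _ 10 (by simp; norm_num)]; decide
    · rw [hmem _ 11 (by simp; norm_num)]; decide

end PlaneKnot

namespace PlaneKnot

open Set

/-! ### Cyclic order on the circle -/

/-! Record a diagram by its Gauss diagram: one arrow on the circle for each crossing, from the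
overpass to the underpass, without signs. In the Gauss diagram count the sets of four arrows that
form one fixed pattern (`IsPattern`): with eight places on the circle, arrow `i` runs from place
`2i` to place `2i + 5` modulo 8. The parity of this number is the invariant.

A kink adds an isolated arrow, which no pattern contains (`patternSets_union_singleton`). A second
move adds two parallel arrows; a pattern contains at most one of them and either can replace the
other, so the number changes by an even amount (`ncard_patternSets_pair`). A third move only shifts
the ends of three arrows within three arcs. If the move is descending, a pattern contains at most
one of these arrows (`IsPattern.eq_of_mem_triangle`) and survives the shift; if it is ascending,
this argument fails.

A figure eight diagram has four arrows that either form the pattern or form its reverse, which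
contains no pattern. Inversion exchanges the two cases, so the invariant separates `K` from its
inverse (`IsFigureEightAt.not_sameParity`) and some move is ascending. Inverting all diagrams of the
sequence makes ascending moves descending (`Omega3Ascending.inverse`), so the same argument applied
to the inverses yields a descending move. -/

theorem sameParam_iff {s t : ℝ} : SameParam s t ↔ (s : UnitAddCircle) = t := by
  rw [eq_comm, ← sub_eq_zero, ← AddCircle.coe_sub, AddCircle.coe_eq_zero_iff]
  refine exists_congr fun n => ?_
  rw [zsmul_eq_mul, mul_one]
  constructor <;> intro h <;> linarith

theorem InCyclicOrder.congr {x y z x' y' z' : ℝ} (h : InCyclicOrder x y z)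
    (hx : (x : UnitAddCircle) = x') (hy : (y : UnitAddCircle) = y')
    (hz : (z : UnitAddCircle) = z') : InCyclicOrder x' y' z' := by
  obtain ⟨p, q, h₁, h₂, h₃⟩ := h
  obtain ⟨a, rfl⟩ := sameParam_iff.mpr hx
  obtain ⟨b, rfl⟩ := sameParam_iff.mpr hy
  obtain ⟨c, rfl⟩ := sameParam_iff.mpr hz
  refine ⟨p + a - b, q + a - c, ?_, ?_, ?_⟩ <;> push_cast <;> linarith

theorem int_eq_of_mem_Ioo {x y : ℝ} {m n : ℤ} (hm : x + m ∈ Ioo y (y + 1))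
    (hn : x + n ∈ Ioo y (y + 1)) : m = n := by
  have h₁ : (m : ℝ) < n + 1 := by linarith [hm.2, hn.1]
  have h₂ : (n : ℝ) < m + 1 := by linarith [hm.1, hn.2]
  have h₁' : m < n + 1 := by exact_mod_cast h₁
  have h₂' : n < m + 1 := by exact_mod_cast h₂
  omega

/-- The lifts of `y` and `z` into the unit interval after `x` are unique, so both orders would
compare the same two reals. -/
theorem InCyclicOrder.not_swap {x y z : ℝ} (h : InCyclicOrder x y z) : ¬ InCyclicOrder x z y := by
  obtain ⟨p, q, h₁, h₂, h₃⟩ := h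
  rintro ⟨p', q', k₁, k₂, k₃⟩
  obtain rfl := int_eq_of_mem_Ioo (x := y) (y := x) (m := p) (n := q')
    ⟨h₁, by linarith⟩ ⟨by linarith, k₃⟩
  obtain rfl := int_eq_of_mem_Ioo (x := z) (y := x) (m := q) (n := p')
    ⟨by linarith, h₃⟩ ⟨k₁, by linarith⟩
  linarith

theorem exists_int_mem_Ioo {x y : ℝ} (h : (x : UnitAddCircle) ≠ y) :
    ∃ n : ℤ, x + n ∈ Ioo y (y + 1) := by
  refine ⟨-⌊x - y⌋, ?_, ?_⟩
  · have h₁ := Int.floor_le (x - y)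
    refine lt_of_le_of_ne (by push_cast; linarith) fun e => h ?_
    exact sameParam_iff.mp ⟨-⌊x - y⌋, e⟩
  · have := Int.lt_floor_add_one (x - y)
    push_cast
    linarith

/-- Needed because ascending moves are defined by a negation: for distinct points it becomes the
opposite cyclic order. -/
theorem InCyclicOrder.of_not {x y z : ℝ} (hxy : (x : UnitAddCircle) ≠ y)
    (hyz : (y : UnitAddCircle) ≠ z) (hxz : (x : UnitAddCircle) ≠ z)
    (h : ¬ InCyclicOrder x y z) : InCyclicOrder x z y := by
  obtain ⟨p, hp₁, hp₂⟩ := exists_int_mem_Ioo hxy.symm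
  obtain ⟨q, hq₁, hq₂⟩ := exists_int_mem_Ioo hxz.symm
  rcases lt_trichotomy (y + p) (z + q) with e | e | e
  · exact absurd ⟨p, q, hp₁, e, hq₂⟩ h
  · exact absurd (sameParam_iff.mp ⟨p - q, by push_cast; linarith⟩) hyz
  · exact ⟨q, p, hq₁, e, hp₂⟩

theorem InCyclicOrder.neg {x y z : ℝ} (h : InCyclicOrder x z y) : InCyclicOrder (-x) (-y) (-z) := by
  obtain ⟨p, q, h₁, h₂, h₃⟩ := h
  -- Negating the chain `x < z + p < y + q < x + 1` and adding one turn gives the required lifts.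
  refine ⟨1 - q, 1 - p, ?_, ?_, ?_⟩ <;> push_cast <;> linarith

/-- The image of a real interval in the circle. -/
def arc (α β : ℝ) : Set UnitAddCircle := (fun x : ℝ => (x : UnitAddCircle)) '' Icc α β

theorem coe_mem_arc {α β x : ℝ} : (x : UnitAddCircle) ∈ arc α β ↔ ∃ n : ℤ, x + n ∈ Icc α β := by
  constructor
  · rintro ⟨y, hy, e⟩
    obtain ⟨n, rfl⟩ := sameParam_iff.mpr e.symm
    exact ⟨n, hy⟩
  · rintro ⟨n, hn⟩
    exact ⟨_, hn, (sameParam_iff.mp ⟨n, rfl⟩).symm⟩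

/-- The cyclic order of pairwise disjoint arcs is the cyclic order of any of their points. -/
theorem InCyclicOrder.of_arcs {a b : Fin 3 → ℝ} (hab : ArcsDisjoint a b) {s t : Fin 3 → ℝ}
    (hs : ∀ i, s i ∈ Icc (a i) (b i)) (ht : ∀ i, t i ∈ Icc (a i) (b i)) {i j k : Fin 3}
    (hij : i ≠ j) (hjk : j ≠ k) (hki : k ≠ i) (h : InCyclicOrder (s i) (s j) (s k)) :
    InCyclicOrder (t i) (t j) (t k) := by
  -- If the order of the `t` were reversed, a translate of one arc would contain a point of the
  -- other, against disjointness.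
  have key (i j : Fin 3) (hij : i ≠ j) (p q : ℤ) (h : s i + p < s j + q) : t i + p < t j + q := by
    by_contra! hle
    rcases le_total (t i + p) (s j + q) with h' | h'
    · refine hij (hab i j (t i) (ht i) (t i + p - q) ⟨?_, ?_⟩ ⟨p - q, by push_cast; ring⟩).1
      · linarith [(ht j).1]
      · linarith [(hs j).2]
    · refine hij (hab i j (s j + q - p) ⟨?_, ?_⟩ (s j) (hs j) ⟨p - q, by push_cast; ring⟩).1
      · linarith [(hs i).1]
      · linarith [(ht i).2]
  obtain ⟨p, q, h₁, h₂, h₃⟩ := h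
  refine ⟨p, q, ?_, ?_, ?_⟩
  · simpa using key i j hij 0 p (by simpa using h₁)
  · exact key j k hjk p q h₂
  · simpa using key k i hki q 1 (by simpa using h₃)

/-! ### Eight points in cyclic order -/

/-- Lifts of eight points of the circle that are met in this cyclic order. -/
def IsCyclicChain (x : Fin 8 → ℝ) : Prop := StrictMono x ∧ x 7 < x 0 + 1

theorem IsCyclicChain.lt_add_one {x : Fin 8 → ℝ} (hx : IsCyclicChain x) (i j : Fin 8) :
    x i < x j + 1 :=
  calc x i ≤ x 7 := hx.1.monotone (Fin.le_last i)
    _ < x 0 + 1 := hx.2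
    _ ≤ x j + 1 := by linarith [hx.1.monotone (Fin.zero_le j)]

theorem IsCyclicChain.coe_injective {x : Fin 8 → ℝ} (hx : IsCyclicChain x) :
    Function.Injective fun i => (x i : UnitAddCircle) := by
  intro i j h
  obtain ⟨n, hn⟩ := sameParam_iff.mpr h
  have h₁ := hx.lt_add_one i j
  have h₂ := hx.lt_add_one j i
  have h₃ : (n : ℝ) < 1 := by linarith
  have h₄ : (-1 : ℝ) < n := by linarith
  have h₅ : n < 1 := by exact_mod_cast h₃
  have h₆ : -1 < n := by exact_mod_cast h₄
  obtain rfl : n = 0 := by omega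
  exact hx.1.injective (by simpa using hn.symm)

/-- The indices `i`, `j`, `k` are distinct and in this cyclic order. -/
def IndexCyclic (i j k : Fin 8) : Prop := i < j ∧ j < k ∨ j < k ∧ k < i ∨ k < i ∧ i < j

instance (i j k : Fin 8) : Decidable (IndexCyclic i j k) := by unfold IndexCyclic; infer_instance

/-- Together with its converse `IsCyclicChain.indexCyclic`, this turns questions on points of the
circle into decidable ones on `Fin 8`. -/
theorem IsCyclicChain.inCyclicOrder {x : Fin 8 → ℝ} (hx : IsCyclicChain x) {i j k : Fin 8}
    (h : IndexCyclic i j k) : InCyclicOrder (x i) (x j) (x k) := by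
  have lt {i j : Fin 8} (h : i < j) := hx.1 h
  have h' := hx.lt_add_one
  rcases h with ⟨h₁, h₂⟩ | ⟨h₁, h₂⟩ | ⟨h₁, h₂⟩
  · refine ⟨0, 0, ?_, ?_, ?_⟩ <;> push_cast <;> linarith [lt h₁, lt h₂, h' k i]
  · refine ⟨1, 1, ?_, ?_, ?_⟩ <;> push_cast <;> linarith [lt h₁, lt h₂, h' i j]
  · refine ⟨0, 1, ?_, ?_, ?_⟩ <;> push_cast <;> linarith [lt h₁, lt h₂, h' j k]

theorem InCyclicOrder.ne {x y z : ℝ} (h : InCyclicOrder x y z) :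
    (x : UnitAddCircle) ≠ y ∧ (y : UnitAddCircle) ≠ z ∧ (x : UnitAddCircle) ≠ z := by
  refine ⟨fun e => ?_, fun e => ?_, fun e => ?_⟩
  · obtain ⟨p, q, h₁, h₂, h₃⟩ := h.congr e rfl rfl
    have a₁ : (0 : ℝ) < p := by linarith
    have a₂ : (p : ℝ) < 1 := by linarith
    have a₃ : 0 < p := by exact_mod_cast a₁
    have a₄ : p < 1 := by exact_mod_cast a₂
    omega
  · exact h.not_swap (h.congr rfl e e.symm)
  · obtain ⟨p, q, h₁, h₂, h₃⟩ := h.congr e rfl rfl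
    have a₁ : (0 : ℝ) < q := by linarith
    have a₂ : (q : ℝ) < 1 := by linarith
    have a₃ : 0 < q := by exact_mod_cast a₁
    have a₄ : q < 1 := by exact_mod_cast a₂
    omega

theorem IsCyclicChain.indexCyclic {x : Fin 8 → ℝ} (hx : IsCyclicChain x) {i j k : Fin 8}
    (h : InCyclicOrder (x i) (x j) (x k)) : IndexCyclic i j k := by
  by_contra hn
  obtain ⟨h₁, h₂, h₃⟩ := h.ne
  have h₁' : i ≠ j := by rintro rfl; exact h₁ rfl
  have h₂' : j ≠ k := by rintro rfl; exact h₂ rfl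
  have h₃' : i ≠ k := by rintro rfl; exact h₃ rfl
  refine h.not_swap (hx.inCyclicOrder ?_)
  unfold IndexCyclic at *
  omega

/-- If an arc contains two points of a chain, then it contains all points of the chain on one of
the two sides between them. -/
theorem IsCyclicChain.between {x : Fin 8 → ℝ} (hx : IsCyclicChain x) {α β : ℝ} (hαβ : β < α + 1)
    {i j : Fin 8} (hij : i < j) (hi : (x i : UnitAddCircle) ∈ arc α β)
    (hj : (x j : UnitAddCircle) ∈ arc α β) :
    (∀ m, i < m → m < j → (x m : UnitAddCircle) ∈ arc α β) ∨
      ∀ m, m < i ∨ j < m → (x m : UnitAddCircle) ∈ arc α β := by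
  obtain ⟨p, hp₁, hp₂⟩ := coe_mem_arc.mp hi
  obtain ⟨q, hq₁, hq₂⟩ := coe_mem_arc.mp hj
  have h₁ := hx.1 hij
  have h₂ := hx.lt_add_one
  have a₁ : (q : ℝ) < p + 1 := by linarith
  have a₂ : (p : ℝ) < q + 2 := by linarith [h₂ j i]
  have a₃ : q < p + 1 := by exact_mod_cast a₁
  have a₄ : p < q + 2 := by exact_mod_cast a₂
  -- Equal shifts mean that the arc runs from `x i` forward to `x j`; shifts differing by one mean
  -- that it runs from `x j` through the next turn to `x i`.
  obtain rfl | rfl : p = q ∨ p = q + 1 := by omega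
  · left
    intro m hm₁ hm₂
    exact coe_mem_arc.mpr ⟨p, by linarith [hx.1 hm₁], by linarith [hx.1 hm₂]⟩
  · right
    push_cast at hp₁ hp₂
    rintro m (hm | hm)
    · refine coe_mem_arc.mpr ⟨q + 1, ?_, ?_⟩ <;> push_cast <;> linarith [hx.1 hm, h₂ j m]
    · refine coe_mem_arc.mpr ⟨q, ?_, ?_⟩ <;> linarith [hx.1 hm, h₂ m i]

/-- A point of a chain can be moved within an arc that contains no other point of the chain. -/
theorem IsCyclicChain.update {x : Fin 8 → ℝ} (hx : IsCyclicChain x) {α β : ℝ} {i : Fin 8}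
    (hi : (x i : UnitAddCircle) ∈ arc α β) (hne : ∀ j ≠ i, (x j : UnitAddCircle) ∉ arc α β)
    {z : UnitAddCircle} (hz : z ∈ arc α β) :
    ∃ y : ℝ, (y : UnitAddCircle) = z ∧ IsCyclicChain (Function.update x i y) := by
  obtain ⟨n, hn₁, hn₂⟩ := coe_mem_arc.mp hi
  obtain ⟨w, ⟨hw₁, hw₂⟩, rfl⟩ := hz
  -- No translate of another chain point lies in `[α, β]`, so the new lift `w - n` lies on the same
  -- side of each of them as `x i`. The shifts `n - 1` and `n + 1` give the inequalities across the
  -- turn.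
  have hne' (j : Fin 8) (hj : j ≠ i) (m : ℤ) (hm : x j + m ≤ β) : x j + m < α := by
    by_contra! h
    exact hne j hj (coe_mem_arc.mpr ⟨m, h, hm⟩)
  have hlt (j : Fin 8) (hj : j < i) : x j < w - n := by
    linarith [hne' j hj.ne n (by linarith [hx.1 hj])]
  have hgt (j : Fin 8) (hj : i < j) : w - n < x j := by
    by_contra! h
    linarith [hne' j hj.ne' n (by linarith), hx.1 hj]
  have hlt' (j : Fin 8) (hj : j ≠ i) : x j < w - n + 1 := by
    have := hne' j hj (n - 1) (by push_cast; linarith [hx.lt_add_one j i])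
    push_cast at this
    linarith
  have hgt' (j : Fin 8) (hj : j ≠ i) : w - n < x j + 1 := by
    by_contra! h
    have := hne' j hj (n + 1) (by push_cast; linarith)
    push_cast at this
    linarith [hx.lt_add_one i j]
  refine ⟨w - n, (sameParam_iff.mp ⟨n, by ring⟩), fun j k hjk => ?_, ?_⟩
  · rcases eq_or_ne j i with rfl | hj
    · rw [Function.update_self, Function.update_of_ne hjk.ne']
      exact hgt k hjk
    · rw [Function.update_of_ne hj]
      rcases eq_or_ne k i with rfl | hk
      · rw [Function.update_self]
        exact hlt j hjk
      · rw [Function.update_of_ne hk]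
        exact hx.1 hjk
  · rcases eq_or_ne i 0 with rfl | h0
    · simpa using hlt' 7 (by decide)
    · rw [Function.update_of_ne h0.symm]
      rcases eq_or_ne i 7 with rfl | h7
      · simpa using hgt' 0 (by decide)
      · rw [Function.update_of_ne h7.symm]
        exact hx.2

/-! ### A pattern of four arrows -/

/-- The positions of the overpasses in the pattern. -/
def overIndex : Fin 4 → Fin 8 := ![0, 2, 4, 6]

/-- The positions of the underpasses in the pattern. -/
def underIndex : Fin 4 → Fin 8 := ![5, 7, 1, 3]

theorem exists_index (m : Fin 8) : (∃ i, overIndex i = m) ∨ ∃ i, underIndex i = m := by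
  revert m
  decide

/-- Four arrows on the circle (from the overpass to the underpass of a crossing) whose ends are met
in the cyclic order over 0, under 2, over 1, under 3, over 2, under 0, over 3, under 1. -/
def IsPattern (c : Fin 4 → UnitAddCircle × UnitAddCircle) : Prop :=
  ∃ x : Fin 8 → ℝ, IsCyclicChain x ∧ ∀ i, c i = (↑(x (overIndex i)), ↑(x (underIndex i)))

theorem overIndex_injective : Function.Injective overIndex := by decide

theorem underIndex_injective : Function.Injective underIndex := by decide

theorem IsPattern.injective {c : Fin 4 → UnitAddCircle × UnitAddCircle} (hc : IsPattern c) :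
    Function.Injective c := by
  obtain ⟨x, hx, hc⟩ := hc
  intro i j h
  rw [hc, hc] at h
  exact overIndex_injective (hx.coe_injective (congrArg Prod.fst h))

/-! ### Ends of a pattern that lie in a common short arc -/

/-- Overpasses and underpasses alternate in the pattern, so there is an underpass on either side
between two overpasses. This forbids two arrows of a pattern from starting on a strand of a move on
which no arrow ends. -/
theorem IsPattern.exists_snd_mem_arc {c : Fin 4 → UnitAddCircle × UnitAddCircle}
    (hc : IsPattern c) {α β : ℝ} (hαβ : β < α + 1) {i j : Fin 4} (hij : i ≠ j)
    (hi : (c i).1 ∈ arc α β) (hj : (c j).1 ∈ arc α β) : ∃ k, (c k).2 ∈ arc α β := by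
  obtain ⟨x, hx, hc⟩ := hc
  simp only [hc] at *
  have key : ∀ i j, overIndex i < overIndex j →
      (∃ k, overIndex i < underIndex k ∧ underIndex k < overIndex j) ∧
      ∃ k, underIndex k < overIndex i ∨ overIndex j < underIndex k := by decide
  have main (i j : Fin 4) (h : overIndex i < overIndex j) (hi : ↑(x (overIndex i)) ∈ arc α β)
      (hj : ↑(x (overIndex j)) ∈ arc α β) : ∃ k, ↑(x (underIndex k)) ∈ arc α β := by
    obtain ⟨⟨k, hk₁, hk₂⟩, l, hl⟩ := key i j h
    rcases hx.between hαβ h hi hj with hb | hb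
    exacts [⟨k, hb _ hk₁ hk₂⟩, ⟨l, hb _ hl⟩]
  have htri : ∀ i j, i ≠ j → overIndex i < overIndex j ∨ overIndex j < overIndex i := by decide
  rcases htri i j hij with h | h
  exacts [main i j h hi hj, main j i h hj hi]

/-- The same alternation, for two arrows that end on the bottom strand of a third move. -/
theorem IsPattern.exists_fst_mem_arc {c : Fin 4 → UnitAddCircle × UnitAddCircle}
    (hc : IsPattern c) {α β : ℝ} (hαβ : β < α + 1) {i j : Fin 4} (hij : i ≠ j)
    (hi : (c i).2 ∈ arc α β) (hj : (c j).2 ∈ arc α β) : ∃ k, (c k).1 ∈ arc α β := by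
  obtain ⟨x, hx, hc⟩ := hc
  simp only [hc] at *
  have key : ∀ i j, underIndex i < underIndex j →
      (∃ k, underIndex i < overIndex k ∧ overIndex k < underIndex j) ∧
      ∃ k, overIndex k < underIndex i ∨ underIndex j < overIndex k := by decide
  have main (i j : Fin 4) (h : underIndex i < underIndex j) (hi : ↑(x (underIndex i)) ∈ arc α β)
      (hj : ↑(x (underIndex j)) ∈ arc α β) : ∃ k, ↑(x (overIndex k)) ∈ arc α β := by
    obtain ⟨⟨k, hk₁, hk₂⟩, l, hl⟩ := key i j h
    rcases hx.between hαβ h hi hj with hb | hb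
    exacts [⟨k, hb _ hk₁ hk₂⟩, ⟨l, hb _ hl⟩]
  have htri : ∀ i j, i ≠ j → underIndex i < underIndex j ∨ underIndex j < underIndex i := by decide
  rcases htri i j hij with h | h
  exacts [main i j h hi hj, main j i h hj hi]

/-- The ends of arrow `i` are the places `2i` and `2i + 5` modulo 8, and both sides between them
contain a further overpass. Hence no arrow of a pattern is isolated. -/
theorem IsPattern.exists_ne_mem_arc {c : Fin 4 → UnitAddCircle × UnitAddCircle}
    (hc : IsPattern c) {α β : ℝ} (hαβ : β < α + 1) {i : Fin 4}
    (hi : (c i).1 ∈ arc α β) (hj : (c i).2 ∈ arc α β) : ∃ k ≠ i, (c k).1 ∈ arc α β := by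
  obtain ⟨x, hx, hc⟩ := hc
  simp only [hc] at *
  have key : ∀ i, (overIndex i < underIndex i →
      (∃ k ≠ i, overIndex i < overIndex k ∧ overIndex k < underIndex i) ∧
      ∃ k ≠ i, overIndex k < overIndex i ∨ underIndex i < overIndex k) ∧
      (underIndex i < overIndex i →
      (∃ k ≠ i, underIndex i < overIndex k ∧ overIndex k < overIndex i) ∧
      ∃ k ≠ i, overIndex k < underIndex i ∨ overIndex i < overIndex k) := by decide
  have htri : ∀ i, overIndex i < underIndex i ∨ underIndex i < overIndex i := by decide
  rcases htri i with h | h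
  · obtain ⟨⟨k, hki, hk₁, hk₂⟩, l, hli, hl⟩ := (key i).1 h
    rcases hx.between hαβ h hi hj with hb | hb
    exacts [⟨k, hki, hb _ hk₁ hk₂⟩, ⟨l, hli, hb _ hl⟩]
  · obtain ⟨⟨k, hki, hk₁, hk₂⟩, l, hli, hl⟩ := (key i).2 h
    rcases hx.between hαβ h hj hi with hb | hb
    exacts [⟨k, hki, hb _ hk₁ hk₂⟩, ⟨l, hli, hb _ hl⟩]

/-- The choice of the pattern pays off here. The hypotheses make the end of arrow `i` and the start
of arrow `j` neighbours. For `i = 0` the end is place 5, its neighbours 4 and 6 are the starts of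
arrows 2 and 3, and these end at places 1 and 3, between 0 and 5; the other `i` follow by rotation.
With the shared arc as middle strand the order is top, bottom, middle, which a descending move
excludes. -/
theorem IsPattern.inCyclicOrder {c : Fin 4 → UnitAddCircle × UnitAddCircle}
    (hc : IsPattern c) {α β : ℝ} (hαβ : β < α + 1) {i j : Fin 4} (hij : i ≠ j)
    (hi : (c i).2 ∈ arc α β) (hj : (c j).1 ∈ arc α β) (hi' : ∀ k, (c k).2 ∈ arc α β → k = i)
    (hj' : ∀ k, (c k).1 ∈ arc α β → k = j) :
    ∃ t b m : ℝ, InCyclicOrder t b m ∧ (c i).1 = t ∧ (c j).2 = b ∧ (c i).2 = m := by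
  obtain ⟨x, hx, hc⟩ := hc
  simp only [hc] at *
  refine ⟨_, _, _, hx.inCyclicOrder ?_, rfl, rfl, rfl⟩
  have honly (m : Fin 8) (hm : ↑(x m) ∈ arc α β) : m = underIndex i ∨ m = overIndex j := by
    rcases exists_index m with ⟨k, rfl⟩ | ⟨k, rfl⟩
    · exact Or.inr (congrArg _ (hj' k hm))
    · exact Or.inl (congrArg _ (hi' k hm))
  -- If the order fails, the two ends are not neighbours: either side between them contains a third
  -- end, and by `IsCyclicChain.between` the arc would contain it.
  have key : ∀ i j, i ≠ j → ¬ IndexCyclic (overIndex i) (underIndex j) (underIndex i) →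
      (underIndex i < overIndex j → (∃ m, underIndex i < m ∧ m < overIndex j) ∧
        ∃ m, m < underIndex i ∨ overIndex j < m) ∧
      (overIndex j < underIndex i → (∃ m, overIndex j < m ∧ m < underIndex i) ∧
        ∃ m, m < overIndex j ∨ underIndex i < m) := by decide
  by_contra hn
  obtain ⟨h₁, h₂⟩ := key i j hij hn
  have htri : ∀ i j, underIndex i < overIndex j ∨ overIndex j < underIndex i := by decide
  rcases htri i j with h | h
  · obtain ⟨⟨k, hk₁, hk₂⟩, l, hl⟩ := h₁ h
    rcases hx.between hαβ h hi hj with hb | hb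
    · have := honly k (hb _ hk₁ hk₂)
      omega
    · have := honly l (hb _ hl)
      omega
  · obtain ⟨⟨k, hk₁, hk₂⟩, l, hl⟩ := h₂ h
    rcases hx.between hαβ h hj hi with hb | hb
    · have := honly k (hb _ hk₁ hk₂)
      omega
    · have := honly l (hb _ hl)
      omega

theorem overIndex_ne_underIndex (i j : Fin 4) : overIndex i ≠ underIndex j := by
  revert i j
  decide

/-- The ends of arrow `i` are moved one after the other, neither passing another end; the second
move starts from the chain already changed by the first. -/
theorem IsPattern.update {c : Fin 4 → UnitAddCircle × UnitAddCircle} (hc : IsPattern c)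
    {α β α' β' : ℝ} (hdis : ∀ z ∈ arc α β, z ∉ arc α' β') {i : Fin 4} (hi : (c i).1 ∈ arc α β)
    (hi' : (c i).2 ∈ arc α' β')
    (hne : ∀ j ≠ i, ((c j).1 ∉ arc α β ∧ (c j).2 ∉ arc α β) ∧
      ((c j).1 ∉ arc α' β' ∧ (c j).2 ∉ arc α' β')) {s t : UnitAddCircle}
    (hs : s ∈ arc α β) (ht : t ∈ arc α' β') : IsPattern (Function.update c i (s, t)) := by
  obtain ⟨x, hx, hc⟩ := hc
  simp only [hc] at hi hi' hne
  obtain ⟨y, rfl, hy⟩ := hx.update hi (fun m hm => by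
    rcases exists_index m with ⟨k, rfl⟩ | ⟨k, rfl⟩
    · exact (hne k fun e => hm (congrArg _ e)).1.1
    · rcases eq_or_ne k i with rfl | hk
      · exact fun h => hdis _ h hi'
      · exact (hne k hk).1.2) hs
  obtain ⟨z, rfl, hz⟩ := hy.update (i := underIndex i)
    (by rwa [Function.update_of_ne (overIndex_ne_underIndex i i).symm]) (fun m hm => by
    rcases exists_index m with ⟨k, rfl⟩ | ⟨k, rfl⟩
    · rcases eq_or_ne k i with rfl | hk
      · rw [Function.update_self]
        exact hdis _ hs
      · rw [Function.update_of_ne fun e => hk (overIndex_injective e)]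
        exact (hne k hk).2.1
    · rw [Function.update_of_ne (overIndex_ne_underIndex i k).symm]
      exact (hne k fun e => hm (congrArg _ e)).2.2) ht
  refine ⟨_, hz, fun k => ?_⟩
  rcases eq_or_ne k i with rfl | hk
  · simp [Function.update_of_ne (overIndex_ne_underIndex _ _)]
  · rw [Function.update_of_ne hk, hc, Function.update_of_ne (overIndex_ne_underIndex _ _),
      Function.update_of_ne fun e => hk (overIndex_injective e), Function.update_of_ne fun e => hk (underIndex_injective e),
      Function.update_of_ne (overIndex_ne_underIndex _ _).symm]

/-! ### Counting patterns when arrows are replaced -/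

/-- The sets of four arrows of `X` that form the pattern. -/
def patternSets (X : Set (UnitAddCircle × UnitAddCircle)) :
    Set (Set (UnitAddCircle × UnitAddCircle)) :=
  {S | S ⊆ X ∧ ∃ c, IsPattern c ∧ range c = S}

theorem patternSets_mono {X Y : Set (UnitAddCircle × UnitAddCircle)} (h : X ⊆ Y) :
    patternSets X ⊆ patternSets Y := fun _ hS => ⟨hS.1.trans h, hS.2⟩

theorem finite_patternSets {X : Set (UnitAddCircle × UnitAddCircle)} (h : X.Finite) :
    (patternSets X).Finite := h.finite_subsets.subset fun _ hS => hS.1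

/-- Replacing arrows by arrows with ends in the same arcs does not decrease the number of patterns
if no pattern contains two of the replaced arrows. -/
theorem ncard_patternSets_le {ι κ : Type*} [Finite ι] {O : Set (UnitAddCircle × UnitAddCircle)}
    (hfin : O.Finite) {a b : κ → ℝ}
    (hdis : ∀ k l, ∀ z ∈ arc (a k) (b k), z ∈ arc (a l) (b l) → k = l)
    (hO : ∀ p ∈ O, ∀ k, p.1 ∉ arc (a k) (b k) ∧ p.2 ∉ arc (a k) (b k)) {src tgt : ι → κ}
    (hst : ∀ k, src k ≠ tgt k) (hinj : ∀ k l, src k = src l → tgt k = tgt l → k = l)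
    {e e' : ι → UnitAddCircle × UnitAddCircle}
    (he : ∀ k, (e k).1 ∈ arc (a (src k)) (b (src k)) ∧ (e k).2 ∈ arc (a (tgt k)) (b (tgt k)))
    (he' : ∀ k, (e' k).1 ∈ arc (a (src k)) (b (src k)) ∧ (e' k).2 ∈ arc (a (tgt k)) (b (tgt k)))
    (honce : ∀ c, IsPattern c → range c ⊆ O ∪ range e →
      ∀ i j, c i ∈ range e → c j ∈ range e → i = j) :
    (patternSets (O ∪ range e)).ncard ≤ (patternSets (O ∪ range e')).ncard := by
  have injective {e : ι → UnitAddCircle × UnitAddCircle} (he : ∀ k, (e k).1 ∈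
      arc (a (src k)) (b (src k)) ∧ (e k).2 ∈ arc (a (tgt k)) (b (tgt k))) :
      Function.Injective e := fun k l h =>
    hinj k l (hdis _ _ _ (he k).1 (h ▸ (he l).1)) (hdis _ _ _ (he k).2 (h ▸ (he l).2))
  have hei := injective he
  -- The extension sends `e k` to `e' k` and fixes all other arrows; taking images under it will map
  -- patterns to patterns injectively.
  have hτe (k) : Function.extend e e' id (e k) = e' k := hei.extend_apply e' id k
  have hτO (p) (hp : p ∈ O) : Function.extend e e' id p = p :=
    Function.extend_apply' _ _ _ (by rintro ⟨k, rfl⟩; exact (hO _ hp _).1 (he k).1)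
  set τ := Function.extend e e' id
  have hτ : InjOn τ (O ∪ range e) := by
    rintro p (hp | ⟨k, rfl⟩) q (hq | ⟨l, rfl⟩) h
    · rwa [hτO p hp, hτO q hq] at h
    · rw [hτO p hp, hτe] at h
      exact absurd (h ▸ (he' l).1) (hO p hp _).1
    · rw [hτO q hq, hτe] at h
      exact absurd (h ▸ (he' k).1) (hO q hq _).1
    · rw [hτe, hτe] at h
      exact congrArg e (injective he' h)
  refine ncard_le_ncard_of_injOn (fun S => τ '' S) ?_ (fun S hS T hT h =>
    (hτ.image_eq_image_iff hS.1 hT.1).mp h)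
    (finite_patternSets (hfin.union (finite_range e')))
  rintro S ⟨hS, c, hc, rfl⟩
  refine ⟨?_, τ ∘ c, ?_, range_comp _ _⟩
  · rintro _ ⟨p, hp, rfl⟩
    rcases hS hp with hp | ⟨k, rfl⟩
    · rw [hτO p hp]
      exact Or.inl hp
    · rw [hτe]
      exact Or.inr ⟨k, rfl⟩
  -- By `honce` at most one arrow of the pattern changes, so `IsPattern.update` suffices.
  · by_cases h : ∃ i, c i ∈ range e
    · obtain ⟨i, k, hk⟩ := h
      have hout (j : Fin 4) (hj : j ≠ i) : c j ∈ O :=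
        (hS ⟨j, rfl⟩).resolve_right fun h => hj (honce c hc hS _ _ h ⟨k, hk⟩)
      have heq : τ ∘ c = Function.update c i (e' k) := by
        funext j
        rcases eq_or_ne j i with rfl | hj
        · rw [Function.update_self, Function.comp_apply, ← hk, hτe]
        · rw [Function.update_of_ne hj, Function.comp_apply, hτO _ (hout j hj)]
      rw [heq]
      refine hc.update (fun z h₁ h₂ => hst k (hdis _ _ z h₁ h₂)) (hk ▸ (he k).1) (hk ▸ (he k).2)
        (fun j hj => ⟨hO _ (hout j hj) _, hO _ (hout j hj) _⟩) (he' k).1 (he' k).2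
    · have heq : τ ∘ c = c := by
        funext j
        exact hτO _ ((hS ⟨j, rfl⟩).resolve_right fun h' => h ⟨j, h'⟩)
      rwa [heq]

/-- An arrow with both ends in an arc without other ends lies in no pattern. -/
theorem patternSets_union_singleton {O : Set (UnitAddCircle × UnitAddCircle)} {α β : ℝ}
    (hαβ : β < α + 1) (hO : ∀ p ∈ O, p.1 ∉ arc α β ∧ p.2 ∉ arc α β)
    {e : UnitAddCircle × UnitAddCircle} (he : e.1 ∈ arc α β ∧ e.2 ∈ arc α β) :
    patternSets (O ∪ {e}) = patternSets O := by
  refine Subset.antisymm ?_ (patternSets_mono subset_union_left)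
  rintro S ⟨hS, c, hc, rfl⟩
  refine ⟨?_, c, hc, rfl⟩
  rintro _ ⟨i, rfl⟩
  refine (hS ⟨i, rfl⟩).resolve_right fun hi => ?_
  rw [mem_singleton_iff] at hi
  obtain ⟨k, hki, hk⟩ := hc.exists_ne_mem_arc hαβ (hi ▸ he.1) (hi ▸ he.2)
  rcases hS ⟨k, rfl⟩ with h | h
  · exact (hO _ h).1 hk
  · exact hki (hc.injective (h.trans hi.symm))

/-- Two arrows between the same two arcs do not change the parity of the number of patterns. -/
theorem ncard_patternSets_pair {O : Set (UnitAddCircle × UnitAddCircle)} (hfin : O.Finite)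
    {a b : Fin 2 → ℝ} (hab : ∀ k, b k < a k + 1)
    (hdis : ∀ k l, ∀ z ∈ arc (a k) (b k), z ∈ arc (a l) (b l) → k = l)
    (hO : ∀ p ∈ O, ∀ k, p.1 ∉ arc (a k) (b k) ∧ p.2 ∉ arc (a k) (b k))
    {e e' : UnitAddCircle × UnitAddCircle} (hne : e ≠ e')
    (he : e.1 ∈ arc (a 0) (b 0) ∧ e.2 ∈ arc (a 1) (b 1))
    (he' : e'.1 ∈ arc (a 0) (b 0) ∧ e'.2 ∈ arc (a 1) (b 1)) :
    (patternSets (O ∪ {e, e'})).ncard ≡ (patternSets O).ncard [MOD 2] := by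
  -- A single replaced arrow occurs only once in a pattern. Used in both directions, this shows that
  -- either arrow alone gives the same number of patterns.
  have le {e e' : UnitAddCircle × UnitAddCircle}
      (he : e.1 ∈ arc (a 0) (b 0) ∧ e.2 ∈ arc (a 1) (b 1))
      (he' : e'.1 ∈ arc (a 0) (b 0) ∧ e'.2 ∈ arc (a 1) (b 1)) :
      (patternSets (O ∪ {e})).ncard ≤ (patternSets (O ∪ {e'})).ncard := by
    have := ncard_patternSets_le (ι := Unit) hfin hdis hO (src := fun _ => 0) (tgt := fun _ => 1)
      (by simp) (by simp) (e := fun _ => e) (e' := fun _ => e') (by simpa using he)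
      (by simpa using he') (fun c hc _ i j hi hj => by
        simp only [range_const, mem_singleton_iff] at hi hj
        exact hc.injective (hi.trans hj.symm))
    simpa using this
  -- Two starts in arc 0 would force an end in arc 0, but `e` and `e'` end in arc 1 and the other
  -- arrows avoid both arcs.
  have hsub (S) (hS : S ∈ patternSets (O ∪ {e, e'})) : e ∉ S ∨ e' ∉ S := by
    by_contra! h
    obtain ⟨hS, c, hc, rfl⟩ := hS
    obtain ⟨⟨i, rfl⟩, j, rfl⟩ := h
    obtain ⟨k, hk⟩ := hc.exists_snd_mem_arc (hab 0) (fun h => hne (congrArg c h)) he.1 he'.1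
    rcases hS ⟨k, rfl⟩ with h | h | h
    · exact (hO _ h 0).2 hk
    · exact absurd (hdis _ _ _ (h ▸ hk) he.2) (by decide)
    · exact absurd (hdis _ _ _ (h ▸ hk) he'.2) (by decide)
  have hunion : patternSets (O ∪ {e, e'}) = patternSets (O ∪ {e}) ∪ patternSets (O ∪ {e'}) := by
    refine Subset.antisymm (fun S hS => ?_) (union_subset (patternSets_mono ?_)
      (patternSets_mono ?_))
    · rcases hsub S hS with h | h
      · refine Or.inr ⟨fun p hp => ?_, hS.2⟩
        rcases hS.1 hp with hp' | rfl | hp'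
        exacts [Or.inl hp', absurd hp h, Or.inr hp']
      · refine Or.inl ⟨fun p hp => ?_, hS.2⟩
        rcases hS.1 hp with hp' | hp' | rfl
        exacts [Or.inl hp', Or.inr hp', absurd hp h]
    · gcongr
      simp
    · gcongr
      simp
  have hinter : patternSets (O ∪ {e}) ∩ patternSets (O ∪ {e'}) = patternSets O := by
    refine Subset.antisymm (fun S hS => ⟨fun p hp => ?_, hS.1.2⟩) (subset_inter
      (patternSets_mono subset_union_left) (patternSets_mono subset_union_left))
    rcases hS.1.1 hp with h | h
    · exact h
    · rcases hS.2.1 hp with h' | h'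
      · exact h'
      · exact absurd (h.symm.trans h') hne
  -- Inclusion-exclusion: the number with both arrows plus the number with neither is twice the
  -- number with one of them.
  have hcard := ncard_union_add_ncard_inter (patternSets (O ∪ {e})) (patternSets (O ∪ {e'}))
    (finite_patternSets (hfin.union (finite_singleton _)))
    (finite_patternSets (hfin.union (finite_singleton _)))
  rw [← hunion, hinter, le_antisymm (le he he') (le he' he)] at hcard
  unfold Nat.ModEq
  omega

/-- The pattern does not contain two of three arrows from the first to the second, the first to
the third and the second to the third of three arcs in this cyclic order. -/
theorem IsPattern.eq_of_mem_triangle {O : Set (UnitAddCircle × UnitAddCircle)}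
    {a b : Fin 3 → ℝ} (hab : ∀ k, b k < a k + 1)
    (hdis : ∀ k l, ∀ z ∈ arc (a k) (b k), z ∈ arc (a l) (b l) → k = l)
    (hO : ∀ p ∈ O, ∀ k, p.1 ∉ arc (a k) (b k) ∧ p.2 ∉ arc (a k) (b k))
    (hcyc : ∀ t m b' : ℝ, ↑t ∈ arc (a 0) (b 0) → ↑m ∈ arc (a 1) (b 1) → ↑b' ∈ arc (a 2) (b 2) →
      InCyclicOrder t m b') {e : Fin 3 → UnitAddCircle × UnitAddCircle}
    (he : ∀ k, (e k).1 ∈ arc (a (![0, 0, 1] k)) (b (![0, 0, 1] k)) ∧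
      (e k).2 ∈ arc (a (![1, 2, 2] k)) (b (![1, 2, 2] k)))
    {c : Fin 4 → UnitAddCircle × UnitAddCircle} (hc : IsPattern c) (hsub : range c ⊆ O ∪ range e)
    {i j : Fin 4} (hi : c i ∈ range e) (hj : c j ∈ range e) : i = j := by
  by_contra hij
  have hfst (k l) (h : (c k).1 ∈ arc (a l) (b l)) : ∃ m, c k = e m ∧ ![0, 0, 1] m = l := by
    rcases hsub ⟨k, rfl⟩ with h' | ⟨m, hm⟩
    · exact absurd h (hO _ h' _).1
    · exact ⟨m, hm.symm, hdis _ _ _ (he m).1 (hm ▸ h)⟩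
  have hsnd (k l) (h : (c k).2 ∈ arc (a l) (b l)) : ∃ m, c k = e m ∧ ![1, 2, 2] m = l := by
    rcases hsub ⟨k, rfl⟩ with h' | ⟨m, hm⟩
    · exact absurd h (hO _ h' _).2
    · exact ⟨m, hm.symm, hdis _ _ _ (he m).2 (hm ▸ h)⟩
  -- Both arrows start on the top strand, on which no arrow ends.
  have h01 {i j} (hij : i ≠ j) (hi : c i = e 0) (hj : c j = e 1) : False := by
    obtain ⟨k, hk⟩ := hc.exists_snd_mem_arc (hab 0) hij (hi ▸ (he 0).1) (hj ▸ (he 1).1)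
    obtain ⟨m, -, hm⟩ := hsnd k 0 hk
    revert m
    decide
  -- Both arrows end on the bottom strand, on which no arrow starts.
  have h12 {i j} (hij : i ≠ j) (hi : c i = e 1) (hj : c j = e 2) : False := by
    obtain ⟨k, hk⟩ := hc.exists_fst_mem_arc (hab 2) hij (hi ▸ (he 1).2) (hj ▸ (he 2).2)
    obtain ⟨m, -, hm⟩ := hfst k 2 hk
    revert m
    decide
  -- The arrows top to middle and middle to bottom would put the strands in the order top, bottom,
  -- middle, against `hcyc`.
  have h02 {i j} (hij : i ≠ j) (hi : c i = e 0) (hj : c j = e 2) : False := by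
    obtain ⟨t, b', m, h, ht, hb, hm⟩ := hc.inCyclicOrder (hab 1) hij (hi ▸ (he 0).2)
      (hj ▸ (he 2).1) (fun k hk => by
        obtain ⟨m, hm, hm'⟩ := hsnd k 1 hk
        have : m = 0 := by clear hm; revert m; decide
        exact hc.injective (hm.trans (this ▸ hi.symm))) (fun k hk => by
        obtain ⟨m, hm, hm'⟩ := hfst k 1 hk
        have : m = 2 := by clear hm; revert m; decide
        exact hc.injective (hm.trans (this ▸ hj.symm)))
    refine h.not_swap (hcyc _ _ _ ?_ ?_ ?_)
    · exact ht ▸ hi ▸ (he 0).1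
    · exact hm ▸ hi ▸ (he 0).2
    · exact hb ▸ hj ▸ (he 2).2
  obtain ⟨k, hk⟩ := hi
  obtain ⟨l, hl⟩ := hj
  have hkl : k ≠ l := by
    rintro rfl
    exact hij (hc.injective (hk.symm.trans hl))
  fin_cases k <;> fin_cases l <;>
    first
      | exact hkl rfl
      | exact h01 hij hk.symm hl.symm
      | exact h12 hij hk.symm hl.symm
      | exact h02 hij hk.symm hl.symm
      | exact h01 (Ne.symm hij) hl.symm hk.symm
      | exact h12 (Ne.symm hij) hl.symm hk.symm
      | exact h02 (Ne.symm hij) hl.symm hk.symm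

/-- The arrows before and after the move join the same arcs, so replacement is injective in both
directions and the number itself is preserved, not only its parity. -/
theorem ncard_patternSets_triangle {O : Set (UnitAddCircle × UnitAddCircle)} (hfin : O.Finite)
    {a b : Fin 3 → ℝ} (hab : ∀ k, b k < a k + 1)
    (hdis : ∀ k l, ∀ z ∈ arc (a k) (b k), z ∈ arc (a l) (b l) → k = l)
    (hO : ∀ p ∈ O, ∀ k, p.1 ∉ arc (a k) (b k) ∧ p.2 ∉ arc (a k) (b k))
    (hcyc : ∀ t m b' : ℝ, ↑t ∈ arc (a 0) (b 0) → ↑m ∈ arc (a 1) (b 1) → ↑b' ∈ arc (a 2) (b 2) →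
      InCyclicOrder t m b') {e e' : Fin 3 → UnitAddCircle × UnitAddCircle}
    (he : ∀ k, (e k).1 ∈ arc (a (![0, 0, 1] k)) (b (![0, 0, 1] k)) ∧
      (e k).2 ∈ arc (a (![1, 2, 2] k)) (b (![1, 2, 2] k)))
    (he' : ∀ k, (e' k).1 ∈ arc (a (![0, 0, 1] k)) (b (![0, 0, 1] k)) ∧
      (e' k).2 ∈ arc (a (![1, 2, 2] k)) (b (![1, 2, 2] k))) :
    (patternSets (O ∪ range e)).ncard = (patternSets (O ∪ range e')).ncard := by
  refine le_antisymm ?_ ?_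
  · exact ncard_patternSets_le hfin hdis hO (by decide) (by decide) he he'
      fun c hc hsub i j hi hj => hc.eq_of_mem_triangle hab hdis hO hcyc he hsub hi hj
  · exact ncard_patternSets_le hfin hdis hO (by decide) (by decide) he' he
      fun c hc hsub i j hi hj => hc.eq_of_mem_triangle hab hdis hO hcyc he' hsub hi hj

/-! ### The arrows of a diagram -/

theorem KnotDiagram.γ_eq_of_coe_eq (K : KnotDiagram) {s t : ℝ} (h : (s : UnitAddCircle) = t) :
    K.γ s = K.γ t := by
  obtain ⟨n, rfl⟩ := sameParam_iff.mpr h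
  simpa using ((show Function.Periodic K.γ 1 from K.periodic).int_mul n s).symm

theorem KnotDiagram.mem_overpass_of_coe_eq (K : KnotDiagram) {s t : ℝ}
    (h : (s : UnitAddCircle) = t) : s ∈ K.overpass ↔ t ∈ K.overpass := by
  obtain ⟨n, rfl⟩ := sameParam_iff.mpr h
  have hp : Function.Periodic (fun x => x ∈ K.overpass) 1 :=
    fun x => propext (K.overpass_periodic x)
  simpa using (hp.int_mul n s).symm

/-- The arrows of a diagram lead from the overpass to the underpass of a crossing. -/
def arrows (K : KnotDiagram) : Set (UnitAddCircle × UnitAddCircle) :=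
  {p | ∃ s t : ℝ, Crosses K.γ s t ∧ s ∈ K.overpass ∧ p = (↑s, ↑t)}

theorem coe_mem_arrows {K : KnotDiagram} {s t : ℝ} :
    ((s : UnitAddCircle), (t : UnitAddCircle)) ∈ arrows K ↔
      K.γ s = K.γ t ∧ (s : UnitAddCircle) ≠ t ∧ s ∈ K.overpass := by
  constructor
  · rintro ⟨s', t', ⟨h₁, h₂⟩, h₃, h⟩
    have hs := congrArg Prod.fst h
    have ht := congrArg Prod.snd h
    refine ⟨?_, ?_, (K.mem_overpass_of_coe_eq hs).mpr h₃⟩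
    · rw [K.γ_eq_of_coe_eq hs, K.γ_eq_of_coe_eq ht, h₁]
    · rw [sameParam_iff] at h₂
      exact fun e => h₂ (hs.symm.trans (e.trans ht))
  · rintro ⟨h₁, h₂, h₃⟩
    exact ⟨s, t, ⟨h₁, fun e => h₂ (sameParam_iff.mp e)⟩, h₃, rfl⟩

/-- The arrows of the diagrams are both finite or both infinite in number; if they are finite, the
numbers of patterns have the same parity. -/
def SameParity (K L : KnotDiagram) : Prop :=
  ((arrows K).Finite ↔ (arrows L).Finite) ∧ ((arrows K).Finite →
    (patternSets (arrows K)).ncard ≡ (patternSets (arrows L)).ncard [MOD 2])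

theorem SameParity.refl (K : KnotDiagram) : SameParity K K := ⟨Iff.rfl, fun _ => rfl⟩

theorem SameParity.symm {K L : KnotDiagram} (h : SameParity K L) : SameParity L K :=
  ⟨h.1.symm, fun hL => (h.2 (h.1.mpr hL)).symm⟩

theorem SameParity.trans {K L M : KnotDiagram} (h : SameParity K L) (h' : SameParity L M) :
    SameParity K M :=
  ⟨h.1.trans h'.1, fun hK => (h.2 hK).trans (h'.2 (h.1.mp hK))⟩

/-! ### Reparametrization -/

theorem IsCircleDiffeo.strictMono {σ : ℝ → ℝ} (hσ : IsCircleDiffeo σ) : StrictMono σ :=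
  strictMono_of_deriv_pos hσ.2.2

theorem IsCircleDiffeo.add_int {σ : ℝ → ℝ} (hσ : IsCircleDiffeo σ) (t : ℝ) (n : ℤ) :
    σ (t + n) = σ t + n := by
  have hp : Function.Periodic (fun x => σ x - x) 1 := fun x => by
    have := hσ.2.1 x
    linarith
  have := hp.int_mul n t
  simp only [mul_one] at this
  linarith

theorem IsCircleDiffeo.surjective {σ : ℝ → ℝ} (hσ : IsCircleDiffeo σ) :
    Function.Surjective σ := by
  intro y
  have h (n : ℤ) : σ n = σ 0 + n := by simpa using hσ.add_int 0 n
  refine mem_range_of_exists_le_of_exists_ge hσ.1.continuous ⟨⌊y - σ 0⌋, ?_⟩ ⟨⌈y - σ 0⌉, ?_⟩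
  · rw [h]
    linarith [Int.floor_le (y - σ 0)]
  · rw [h]
    linarith [Int.le_ceil (y - σ 0)]

theorem IsCircleDiffeo.coe_eq_iff {σ : ℝ → ℝ} (hσ : IsCircleDiffeo σ) {s t : ℝ} :
    (σ s : UnitAddCircle) = σ t ↔ (s : UnitAddCircle) = t := by
  rw [← sameParam_iff, ← sameParam_iff]
  refine exists_congr fun n => ?_
  rw [← hσ.add_int, hσ.strictMono.injective.eq_iff]

/-- The lift `σ` induces an injection of the circle that carries the arrows of `L` onto those of
`K`; since `σ` is increasing, chains correspond to chains. Arrows carry no signs, so all that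
matters about `F` is that it neither creates nor destroys double points. -/
theorem sameParity_of_reparametrization {K L : KnotDiagram} {F : Plane → Plane}
    (hF : Function.Injective F) {σ : ℝ → ℝ} (hσ : IsCircleDiffeo σ)
    (h : ∀ t, L.γ t = F (K.γ (σ t)) ∧ (t ∈ L.overpass ↔ σ t ∈ K.overpass)) :
    SameParity K L := by
  have hper : Function.Periodic (fun t => (σ t : UnitAddCircle)) 1 := fun t => by
    simpa using hσ.coe_eq_iff.mpr (sameParam_iff.mp ⟨-1, by push_cast; ring⟩)
  set τ : UnitAddCircle → UnitAddCircle := hper.lift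
  have hτ (t : ℝ) : τ t = σ t := rfl
  have hinj : Function.Injective τ := by
    intro x y
    induction x using QuotientAddGroup.induction_on
    induction y using QuotientAddGroup.induction_on
    exact fun h => hσ.coe_eq_iff.mp h
  have harr : arrows K = Prod.map τ τ '' arrows L := by
    ext ⟨x, y⟩
    constructor
    · induction x using QuotientAddGroup.induction_on with | H s
      induction y using QuotientAddGroup.induction_on with | H t
      obtain ⟨s, rfl⟩ := hσ.surjective s
      obtain ⟨t, rfl⟩ := hσ.surjective t
      intro hm
      obtain ⟨h₁, h₂, h₃⟩ := coe_mem_arrows.mp hm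
      exact ⟨(↑s, ↑t), coe_mem_arrows.mpr ⟨by rw [(h s).1, (h t).1, h₁],
        fun e => h₂ (hσ.coe_eq_iff.mpr e), (h s).2.mpr h₃⟩, rfl⟩
    · rintro ⟨⟨x', y'⟩, hm, e⟩
      rw [← e]
      induction x' using QuotientAddGroup.induction_on with | H s
      induction y' using QuotientAddGroup.induction_on with | H t
      obtain ⟨h₁, h₂, h₃⟩ := coe_mem_arrows.mp hm
      rw [(h s).1, (h t).1] at h₁
      exact coe_mem_arrows.mpr ⟨hF h₁, fun e => h₂ (hσ.coe_eq_iff.mp e), (h s).2.mp h₃⟩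
  have hpat : patternSets (arrows K) = (fun S => Prod.map τ τ '' S) '' patternSets (arrows L) := by
    ext S
    constructor
    · rintro ⟨hS, c, ⟨x, hx, hc⟩, rfl⟩
      choose y hy using fun i => hσ.surjective (x i)
      obtain rfl : (fun i => σ (y i)) = x := funext hy
      have hyc : IsCyclicChain y := by
        refine ⟨fun i j hij => hσ.strictMono.lt_iff_lt.mp (hx.1 hij), ?_⟩
        rw [← hσ.strictMono.lt_iff_lt, hσ.2.1]
        exact hx.2
      have hrange : range c = Prod.map τ τ '' range
          fun i => ((y (overIndex i) : UnitAddCircle), (y (underIndex i) : UnitAddCircle)) := by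
        rw [← range_comp]
        exact congrArg range (funext hc)
      refine ⟨_, ⟨?_, _, ⟨y, hyc, fun i => rfl⟩, rfl⟩, hrange.symm⟩
      rw [hrange, harr] at hS
      exact (image_subset_image_iff (hinj.prodMap hinj)).mp hS
    · rintro ⟨_, ⟨hS, c, ⟨x, hx, hc⟩, rfl⟩, rfl⟩
      refine ⟨harr ▸ image_mono hS, Prod.map τ τ ∘ c,
        ⟨fun i => σ (x i), ⟨hσ.strictMono.comp hx.1, ?_⟩, fun i => ?_⟩, range_comp _ _⟩
      · rw [← hσ.2.1]
        exact hσ.strictMono hx.2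
      · rw [Function.comp_apply, hc]
        rfl
  constructor
  · rw [harr, finite_image_iff (hinj.prodMap hinj).injOn]
  · intro _
    rw [hpat, ncard_image_of_injective _ (image_injective.mpr (hinj.prodMap hinj))]

theorem KnotDiagram.Equivalent.sameParity {K L : KnotDiagram} (h : K.Equivalent L) :
    SameParity K L := by
  obtain ⟨F, ⟨-, ⟨G, -, hG, -⟩, -⟩, σ, hσ, h⟩ := h
  exact sameParity_of_reparametrization (Function.LeftInverse.injective hG) hσ h

theorem KnotDiagram.Same.sameParity {K L : KnotDiagram} (h : K.Same L) : SameParity K L := by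
  obtain ⟨σ, hσ, h⟩ := h
  exact sameParity_of_reparametrization (F := id) Function.injective_id hσ h

/-! ### Moves -/

section Moves

variable {n : ℕ} {a b : Fin n → ℝ}

theorem ArcsDisjoint.lt_add_one (h : ArcsDisjoint a b) (i : Fin n) : b i < a i + 1 := by
  by_contra! hle
  have := (h i i (a i) ⟨le_rfl, by linarith⟩ (a i + 1) ⟨by linarith, hle⟩ ⟨1, by simp⟩).2
  linarith

theorem ArcsDisjoint.eq_of_mem_arc (h : ArcsDisjoint a b) (i j : Fin n) :
    ∀ z ∈ arc (a i) (b i), z ∈ arc (a j) (b j) → i = j := by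
  rintro _ ⟨s, hs, rfl⟩ ⟨t, ht, e⟩
  exact (h i j s hs t ht (sameParam_iff.mpr e.symm)).1

theorem ArcsDisjoint.comp (h : ArcsDisjoint a b) (ord : Equiv.Perm (Fin n)) :
    ArcsDisjoint (a ∘ ord) (b ∘ ord) := fun _ _ s hs t ht e =>
  ⟨ord.injective (h _ _ s hs t ht e).1, (h _ _ s hs t ht e).2⟩

theorem inArcs_iff {t : ℝ} : InArcs a b t ↔ ∃ i, (t : UnitAddCircle) ∈ arc (a i) (b i) :=
  exists_congr fun _ => exists_congr fun _ => and_congr Iff.rfl sameParam_iff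

/-- The arrows with both ends outside the arcs. -/
def outerArrows (K : KnotDiagram) (a b : Fin n → ℝ) : Set (UnitAddCircle × UnitAddCircle) :=
  {p ∈ arrows K | ∀ k, p.1 ∉ arc (a k) (b k) ∧ p.2 ∉ arc (a k) (b k)}

theorem outerArrows_subset {K L : KnotDiagram}
    (h : ∀ t, ¬ InArcs a b t → K.γ t = L.γ t ∧ (t ∈ K.overpass ↔ t ∈ L.overpass)) :
    outerArrows K a b ⊆ outerArrows L a b := by
  rintro ⟨x, y⟩ ⟨hm, hout⟩
  refine ⟨?_, hout⟩
  induction x using QuotientAddGroup.induction_on with | H s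
  induction y using QuotientAddGroup.induction_on with | H t
  have hs := h s fun hs => by
    obtain ⟨k, hk⟩ := inArcs_iff.mp hs
    exact (hout k).1 hk
  have ht := h t fun ht => by
    obtain ⟨k, hk⟩ := inArcs_iff.mp ht
    exact (hout k).2 hk
  obtain ⟨h₁, h₂, h₃⟩ := coe_mem_arrows.mp hm
  exact coe_mem_arrows.mpr ⟨by rw [← hs.1, ← ht.1, h₁], h₂, hs.2.mp h₃⟩

theorem Replaces.outerArrows_eq {m m' : Fin n → ℝ → Plane} {ord : Equiv.Perm (Fin n)}
    {K L : KnotDiagram} (h : Replaces m m' ord a b K L) :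
    outerArrows K a b = outerArrows L a b := by
  obtain ⟨-, φ, ψ, -, -, -, -, -, -, -, -, h⟩ := h
  exact Subset.antisymm (outerArrows_subset h)
    (outerArrows_subset fun t ht => ⟨(h t ht).1.symm, (h t ht).2.symm⟩)

/-- The strands stay inside the unit disk. -/
def InDisk (m : Fin n → ℝ → Plane) : Prop := ∀ i, ∀ u ∈ Icc (-1 : ℝ) 1, m i u ∈ unitDisk

/-- Injectivity of `φ` on the disk reduces crossings inside it to equations between the model
strands. -/
theorem HasPart.exists_param {K : KnotDiagram} {φ : Plane → Plane} {m : Fin n → ℝ → Plane}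
    (h : HasPart K φ m a b) (hφ : InjOn φ unitDisk) (hm : InDisk m) :
    ∃ u : Fin n → ℝ → ℝ, (∀ i, InjOn (u i) (Icc (a i) (b i))) ∧
      (∀ i, ∀ s ∈ Icc (a i) (b i), u i s ∈ Icc (-1 : ℝ) 1) ∧
      (∀ i, ∀ v ∈ Icc (-1 : ℝ) 1, ∃ s ∈ Icc (a i) (b i), u i s = v) ∧
      ∀ i j, ∀ s ∈ Icc (a i) (b i), ∀ t ∈ Icc (a j) (b j),
        (K.γ s = K.γ t ↔ m i (u i s) = m j (u j t)) := by
  choose u hu₁ hu₂ hu₃ using h.1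
  have hmem (i) (s) (hs : s ∈ Icc (a i) (b i)) : u i s ∈ Icc (-1 : ℝ) 1 :=
    hu₂ i ▸ mem_image_of_mem _ hs
  refine ⟨u, fun i => (hu₁ i).elim StrictMonoOn.injOn StrictAntiOn.injOn, hmem,
    fun i v hv => by rwa [← hu₂ i] at hv, fun i j s hs t ht => ?_⟩
  rw [hu₃ i s hs, hu₃ j t ht]
  exact hφ.eq_iff (hm i _ (hmem i s hs)) (hm j _ (hmem j t ht))

theorem HasPart.le {K : KnotDiagram} {φ : Plane → Plane} {m : Fin n → ℝ → Plane}
    (h : HasPart K φ m a b) (i : Fin n) : a i ≤ b i := by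
  obtain ⟨u, -, hu, -⟩ := h.1 i
  have : (1 : ℝ) ∈ u '' Icc (a i) (b i) := hu ▸ ⟨by norm_num, le_rfl⟩
  obtain ⟨s, hs, -⟩ := this
  exact hs.1.trans hs.2

/-- An arrow has both ends outside the arcs or both ends inside. -/
theorem HasPart.mem_arrows {K : KnotDiagram} {φ : Plane → Plane} {m : Fin n → ℝ → Plane}
    (h : HasPart K φ m a b) (hm : InDisk m) {p : UnitAddCircle × UnitAddCircle}
    (hp : p ∈ arrows K) : p ∈ outerArrows K a b ∨ ∃ i j, ∃ s ∈ Icc (a i) (b i),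
      ∃ t ∈ Icc (a j) (b j), p = (↑s, ↑t) := by
  have hin {t : ℝ} (ht : InArcs a b t) : K.γ t ∈ φ '' unitDisk := by
    obtain ⟨i, s, hs, e⟩ := ht
    obtain ⟨u, -, hu, hK⟩ := h.1 i
    rw [← K.γ_eq_of_coe_eq (sameParam_iff.mp e), hK s hs]
    exact mem_image_of_mem _ (hm i _ (hu ▸ mem_image_of_mem _ hs))
  obtain ⟨s, t, hst, ho, rfl⟩ := id hp
  by_cases hs : InArcs a b s
  · by_cases ht : InArcs a b t
    · obtain ⟨i, s', hs', es⟩ := hs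
      obtain ⟨j, t', ht', et⟩ := ht
      exact Or.inr ⟨i, j, s', hs', t', ht',
        Prod.ext (sameParam_iff.mp es).symm (sameParam_iff.mp et).symm⟩
    · exact absurd (hst.1 ▸ hin hs) (h.2 t ht)
  · by_cases ht : InArcs a b t
    · exact absurd (hst.1 ▸ hin ht) (h.2 s hs)
    · rw [inArcs_iff, not_exists] at hs ht
      exact Or.inl ⟨hp, fun k => ⟨hs k, ht k⟩⟩

/-- Arrows lead downwards through the layers. The inequality is not strict, because layering does
not speak of self-crossings of a strand. -/
theorem Layered.lt_of_mem_arrows {K : KnotDiagram} {ord : Equiv.Perm (Fin n)}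
    (h : Layered K ord a b) {p q : Fin n} {s t : ℝ} (hs : s ∈ Icc (a (ord p)) (b (ord p)))
    (ht : t ∈ Icc (a (ord q)) (b (ord q)))
    (hst : ((s : UnitAddCircle), (t : UnitAddCircle)) ∈ arrows K) : p ≤ q := by
  by_contra! hqp
  obtain ⟨h₁, h₂, h₃⟩ := coe_mem_arrows.mp hst
  exact (K.overpass_iff s t ⟨h₁, fun e => h₂ (sameParam_iff.mp e)⟩).mp h₃
    (h q p hqp t ht s hs h₁.symm)

theorem Layered.mem_arrows {K : KnotDiagram} {ord : Equiv.Perm (Fin n)}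
    (h : Layered K ord a b) (hab : ArcsDisjoint a b) {p q : Fin n} (hpq : p < q) {s t : ℝ}
    (hs : s ∈ Icc (a (ord p)) (b (ord p))) (ht : t ∈ Icc (a (ord q)) (b (ord q)))
    (hst : K.γ s = K.γ t) : ((s : UnitAddCircle), (t : UnitAddCircle)) ∈ arrows K :=
  coe_mem_arrows.mpr ⟨hst, fun e => hpq.ne (ord.injective
    (hab _ _ s hs t ht (sameParam_iff.mpr e)).1), h p q hpq s hs t ht hst⟩

theorem HasPart.arrows_eq_outerArrows {K : KnotDiagram} {φ : Plane → Plane}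
    {m : Fin n → ℝ → Plane} (h : HasPart K φ m a b) (hφ : InjOn φ unitDisk) (hm : InDisk m)
    (hno : ∀ i j, ∀ u ∈ Icc (-1 : ℝ) 1, ∀ v ∈ Icc (-1 : ℝ) 1, m i u = m j v → i = j ∧ u = v) :
    arrows K = outerArrows K a b := by
  refine Subset.antisymm (fun p hp => ?_) fun p hp => hp.1
  refine (h.mem_arrows hm hp).resolve_right ?_
  rintro ⟨i, j, s, hs, t, ht, rfl⟩
  obtain ⟨u, hu₁, hu₂, -, hu₃⟩ := h.exists_param hφ hm
  obtain ⟨h₁, h₂, -⟩ := coe_mem_arrows.mp hp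
  obtain ⟨rfl, e⟩ := hno i j _ (hu₂ i s hs) _ (hu₂ j t ht) ((hu₃ i j s hs t ht).mp h₁)
  exact h₂ (congrArg _ (hu₁ i hs ht e))

end Moves

/-- The parts inside the disk are finite, so finiteness is decided by the common outer arrows, and
parity need only be compared when these are finite. -/
theorem sameParity_of_outerArrows {n : ℕ} {a b : Fin n → ℝ} {K L : KnotDiagram}
    {E E' : Set (UnitAddCircle × UnitAddCircle)} (hK : arrows K = outerArrows K a b ∪ E)
    (hL : arrows L = outerArrows K a b ∪ E') (hE : E.Finite) (hE' : E'.Finite)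
    (h : (outerArrows K a b).Finite → (patternSets (outerArrows K a b ∪ E)).ncard ≡
      (patternSets (outerArrows K a b ∪ E')).ncard [MOD 2]) : SameParity K L := by
  refine ⟨?_, fun hf => ?_⟩
  · rw [hK, hL, finite_union, finite_union, and_iff_left hE, and_iff_left hE']
  · rw [hK, hL]
    exact h (hf.subset fun p hp => hp.1)

/-- `SameParity` is an equivalence relation that absorbs reparametrizations, so one direction of the
replacement is enough. -/
theorem Move.sameParity {n : ℕ} {m m' : Fin n → ℝ → Plane}
    {P : Equiv.Perm (Fin n) → (Fin n → ℝ) → Prop}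
    (h : ∀ K L ord a b, P ord a → Replaces m m' ord a b K L → SameParity K L)
    {K L : KnotDiagram} (hKL : Move m m' P K L) : SameParity K L := by
  obtain ⟨K', L', hK, hL, ord, a, b, hP, hr | hr⟩ := hKL
  · exact (hK.sameParity.trans (h _ _ _ _ _ hP hr)).trans hL.sameParity.symm
  · exact (hK.sameParity.trans (h _ _ _ _ _ hP hr).symm).trans hL.sameParity.symm

/-! ### The first move -/

theorem inDisk_omega1Plain : InDisk omega1Plain := by
  intro i u hu
  fin_cases i
  have h : u ^ 2 ≤ 1 := by nlinarith [hu.1, hu.2]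
  simpa [unitDisk, omega1Plain] using h

theorem inDisk_omega1Kink : InDisk omega1Kink := by
  intro i u hu
  fin_cases i
  have h : u ^ 2 ≤ 1 := by nlinarith [hu.1, hu.2]
  simp only [unitDisk, omega1Kink, mem_ofPred_eq]
  simp
  nlinarith [sq_nonneg u, sq_nonneg (u ^ 2), mul_nonneg (sq_nonneg u) (sub_nonneg.mpr h),
    mul_nonneg (sq_nonneg (u ^ 2)) (sub_nonneg.mpr h)]

theorem omega1Plain_injective (i j : Fin 1) (u v : ℝ) (h : omega1Plain i u = omega1Plain j v) :
    i = j ∧ u = v := by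
  fin_cases i
  fin_cases j
  exact ⟨rfl, congrArg Prod.fst h⟩

/-- The second coordinate is even and forces `u = -v`; the first is odd and must then vanish, which
leaves `0` and `±1/2`, and `u ≠ v` excludes `0`. -/
theorem omega1Kink_eq_iff {i j : Fin 1} {u v : ℝ} (huv : u ≠ v) :
    omega1Kink i u = omega1Kink j v ↔ u = 1 / 2 ∧ v = -1 / 2 ∨ u = -1 / 2 ∧ v = 1 / 2 := by
  fin_cases i
  fin_cases j
  simp only [omega1Kink]
  constructor
  · intro h
    have h₁ : u * (4 * u ^ 2 - 1) / 3 = v * (4 * v ^ 2 - 1) / 3 := congrArg Prod.fst h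
    have h₂ : (1 - u ^ 2) / 2 = (1 - v ^ 2) / 2 := congrArg Prod.snd h
    have h₃ : (u - v) * (u + v) = 0 := by linarith
    obtain rfl : u = -v := by
      linarith [(mul_eq_zero.mp h₃).resolve_left (sub_ne_zero.mpr huv)]
    have h₄ : v * ((2 * v - 1) * (2 * v + 1)) = 0 := by nlinarith
    rcases mul_eq_zero.mp h₄ with h | h
    · exact absurd (by rw [h, neg_zero]) huv
    · rcases mul_eq_zero.mp h with h | h
      · right; constructor <;> linarith
      · left; constructor <;> linarith
  · rintro (⟨rfl, rfl⟩ | ⟨rfl, rfl⟩) <;> simp <;> norm_num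

theorem Replaces.sameParity_omega1 {K L : KnotDiagram} {ord : Equiv.Perm (Fin 1)}
    {a b : Fin 1 → ℝ} (h : Replaces omega1Plain omega1Kink ord a b K L) : SameParity K L := by
  have hout := h.outerArrows_eq
  obtain ⟨hab, φ, ψ, hφ, hψ, -, -, hK, hL, -, -, -⟩ := h
  have hKa := hK.arrows_eq_outerArrows hφ.2.1 inDisk_omega1Plain
    fun i j u _ v _ h => omega1Plain_injective i j u v h
  obtain ⟨u, hu₁, hu₂, hu₃, hu₄⟩ := hL.exists_param hψ.2.1 inDisk_omega1Kink
  obtain ⟨s, hs, hsu⟩ := hu₃ 0 (1 / 2) ⟨by norm_num, by norm_num⟩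
  obtain ⟨t, ht, htu⟩ := hu₃ 0 (-1 / 2) ⟨by norm_num, by norm_num⟩
  have hst : L.γ s = L.γ t := by
    rw [hu₄ 0 0 s hs t ht, hsu, htu, omega1Kink_eq_iff (by norm_num)]
    exact Or.inl ⟨rfl, rfl⟩
  have hst' : s ≠ t := fun e => by
    rw [e, htu] at hsu
    norm_num at hsu
  have hcoe : (s : UnitAddCircle) ≠ t := fun e =>
    hst' (hab 0 0 s hs t ht (sameParam_iff.mpr e)).2
  have honly (s' t' : ℝ) (hs' : s' ∈ Icc (a 0) (b 0)) (ht' : t' ∈ Icc (a 0) (b 0))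
      (h : ((s' : UnitAddCircle), (t' : UnitAddCircle)) ∈ arrows L) :
      s' = s ∧ t' = t ∨ s' = t ∧ t' = s := by
    obtain ⟨h₁, h₂, -⟩ := coe_mem_arrows.mp h
    have hne : u 0 s' ≠ u 0 t' := fun e => h₂ (congrArg _ (hu₁ 0 hs' ht' e))
    rw [hu₄ 0 0 s' hs' t' ht', omega1Kink_eq_iff hne, ← hsu, ← htu] at h₁
    rcases h₁ with ⟨h₁, h₁'⟩ | ⟨h₁, h₁'⟩
    · exact Or.inl ⟨hu₁ 0 hs' hs h₁, hu₁ 0 ht' ht h₁'⟩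
    · exact Or.inr ⟨hu₁ 0 hs' ht h₁, hu₁ 0 ht' hs h₁'⟩
  -- With one strand the layering does not tell which passage is over; `main` takes the overpass as
  -- its first parameter and is applied in both cases.
  have main (s t : ℝ) (hs : s ∈ Icc (a 0) (b 0)) (ht : t ∈ Icc (a 0) (b 0))
      (hst : ((s : UnitAddCircle), (t : UnitAddCircle)) ∈ arrows L)
      (honly : ∀ s' t', s' ∈ Icc (a 0) (b 0) → t' ∈ Icc (a 0) (b 0) →
        ((s' : UnitAddCircle), (t' : UnitAddCircle)) ∈ arrows L →
        s' = s ∧ t' = t ∨ s' = t ∧ t' = s) : SameParity K L := by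
    have hLa : arrows L = outerArrows K a b ∪ {(↑s, ↑t)} := by
      rw [hout]
      refine Subset.antisymm (fun p hp => ?_) (union_subset (fun p hp => hp.1) (by simpa using hst))
      refine (hL.mem_arrows inDisk_omega1Kink hp).imp_right ?_
      rintro ⟨i, j, s', hs', t', ht', rfl⟩
      rw [Subsingleton.elim i 0] at hs'
      rw [Subsingleton.elim j 0] at ht'
      rcases honly s' t' hs' ht' hp with ⟨rfl, rfl⟩ | ⟨rfl, rfl⟩
      · rfl
      · obtain ⟨h₁, h₂, h₃⟩ := coe_mem_arrows.mp hp
        obtain ⟨-, -, h₄⟩ := coe_mem_arrows.mp hst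
        exact absurd h₄ ((L.overpass_iff _ _ ⟨h₁, fun e => h₂ (sameParam_iff.mp e)⟩).mp h₃)
    refine sameParity_of_outerArrows (hKa.trans (union_empty _).symm) hLa finite_empty
      (finite_singleton _) fun _ => ?_
    rw [union_empty, patternSets_union_singleton (hab.lt_add_one 0) (fun p hp => hp.2 0)
      ⟨⟨s, hs, rfl⟩, t, ht, rfl⟩]
  by_cases ho : s ∈ L.overpass
  · exact main s t hs ht (coe_mem_arrows.mpr ⟨hst, hcoe, ho⟩) honly
  · have ho' : t ∈ L.overpass :=
      (L.overpass_iff t s ⟨hst.symm, fun e => hcoe (sameParam_iff.mp e).symm⟩).mpr ho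
    exact main t s ht hs (coe_mem_arrows.mpr ⟨hst.symm, hcoe.symm, ho'⟩)
      fun s' t' hs' ht' h => (honly s' t' hs' ht' h).symm

/-! ### The second move -/

theorem inDisk_omega2Plain : InDisk omega2Plain := by
  intro i u hu
  have h : u ^ 2 ≤ 1 := by nlinarith [hu.1, hu.2]
  fin_cases i <;> simp only [unitDisk, omega2Plain, mem_ofPred_eq] <;> simp <;> nlinarith

theorem inDisk_omega2Crossed : InDisk omega2Crossed := by
  intro i u hu
  have h : u ^ 2 ≤ 1 := by nlinarith [hu.1, hu.2]
  fin_cases i <;> simp only [unitDisk, omega2Crossed, mem_ofPred_eq] <;> simp <;>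
    nlinarith [mul_nonneg (sq_nonneg u) (sub_nonneg.mpr h), sq_nonneg u]

theorem omega2Plain_injective (i j : Fin 2) (u v : ℝ) (h : omega2Plain i u = omega2Plain j v) :
    i = j ∧ u = v := by
  have h₁ := congrArg Prod.fst h
  have h₂ := congrArg Prod.snd h
  fin_cases i <;> fin_cases j <;> simp [omega2Plain] at h₁ h₂ ⊢ <;> linarith

theorem omega2Crossed_eq_iff {i j : Fin 2} (hij : i ≠ j) {u v : ℝ} :
    omega2Crossed i u = omega2Crossed j v ↔ u = 1 / 2 ∧ v = 1 / 2 ∨ u = -1 / 2 ∧ v = -1 / 2 := by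
  constructor
  · intro h
    have h₁ : 4 * u / 5 = 4 * v / 5 := by
      have h₁ := congrArg Prod.fst h
      fin_cases i <;> fin_cases j <;> simpa [omega2Crossed] using h₁
    obtain rfl : u = v := by linarith
    have h₂ : (4 * u ^ 2 - 1) / 5 = -((4 * u ^ 2 - 1) / 5) := by
      have h₂ := congrArg Prod.snd h
      fin_cases i <;> fin_cases j
      · exact absurd rfl hij
      · simpa [omega2Crossed] using h₂
      · simpa [omega2Crossed] using h₂.symm
      · exact absurd rfl hij
    have h₃ : (2 * u - 1) * (2 * u + 1) = 0 := by nlinarith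
    rcases mul_eq_zero.mp h₃ with h | h
    · left; constructor <;> linarith
    · right; constructor <;> linarith
  · rintro (⟨rfl, rfl⟩ | ⟨rfl, rfl⟩) <;> fin_cases i <;> fin_cases j <;>
      simp [omega2Crossed] <;> norm_num

theorem omega2Crossed_injective (i : Fin 2) {u v : ℝ} (h : omega2Crossed i u = omega2Crossed i v) :
    u = v := by
  have h₁ := congrArg Prod.fst h
  fin_cases i <;> simp [omega2Crossed] at h₁ <;> linarith

theorem Replaces.sameParity_omega2 {K L : KnotDiagram} {ord : Equiv.Perm (Fin 2)}
    {a b : Fin 2 → ℝ} (h : Replaces omega2Plain omega2Crossed ord a b K L) : SameParity K L := by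
  have hout := h.outerArrows_eq
  obtain ⟨hab, φ, ψ, hφ, hψ, -, -, hK, hL, -, hlay, -⟩ := h
  have hKa := hK.arrows_eq_outerArrows hφ.2.1 inDisk_omega2Plain
    fun i j u _ v _ h => omega2Plain_injective i j u v h
  obtain ⟨u, hu₁, hu₂, hu₃, hu₄⟩ := hL.exists_param hψ.2.1 inDisk_omega2Crossed
  have hord : ord 0 ≠ ord 1 := fun e => absurd (ord.injective e) (by decide)
  obtain ⟨s, hs, hsu⟩ := hu₃ (ord 0) (1 / 2) ⟨by norm_num, by norm_num⟩
  obtain ⟨t, ht, htu⟩ := hu₃ (ord 1) (1 / 2) ⟨by norm_num, by norm_num⟩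
  obtain ⟨s', hs', hsu'⟩ := hu₃ (ord 0) (-1 / 2) ⟨by norm_num, by norm_num⟩
  obtain ⟨t', ht', htu'⟩ := hu₃ (ord 1) (-1 / 2) ⟨by norm_num, by norm_num⟩
  have hst : L.γ s = L.γ t := by
    rw [hu₄ _ _ s hs t ht, omega2Crossed_eq_iff hord]
    exact Or.inl ⟨hsu, htu⟩
  have hst' : L.γ s' = L.γ t' := by
    rw [hu₄ _ _ s' hs' t' ht', omega2Crossed_eq_iff hord]
    exact Or.inr ⟨hsu', htu'⟩
  -- By the layering both crossings give arrows from strand `ord 0` to strand `ord 1`, so the two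
  -- arrows are parallel.
  have hLa : arrows L = outerArrows K a b ∪ {(↑s, ↑t), (↑s', ↑t')} := by
    rw [hout]
    refine Subset.antisymm (fun p hp => ?_) (union_subset (fun p hp => hp.1) ?_)
    · refine (hL.mem_arrows inDisk_omega2Crossed hp).imp_right ?_
      rintro ⟨i, j, x, hx, y, hy, rfl⟩
      obtain ⟨i, rfl⟩ := ord.surjective i
      obtain ⟨j, rfl⟩ := ord.surjective j
      have hle := hlay.lt_of_mem_arrows hx hy hp
      obtain ⟨h₁, h₂, -⟩ := coe_mem_arrows.mp hp
      rw [hu₄ _ _ x hx y hy] at h₁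
      rcases hle.eq_or_lt with rfl | hlt
      · exact absurd (congrArg _ (hu₁ _ hx hy (omega2Crossed_injective _ h₁))) h₂
      · obtain ⟨rfl, rfl⟩ : i = 0 ∧ j = 1 := by omega
        rw [omega2Crossed_eq_iff hord] at h₁
        rcases h₁ with ⟨h₁, h₁'⟩ | ⟨h₁, h₁'⟩
        · left
          rw [hu₁ _ hx hs (h₁.trans hsu.symm), hu₁ _ hy ht (h₁'.trans htu.symm)]
        · right
          rw [hu₁ _ hx hs' (h₁.trans hsu'.symm), hu₁ _ hy ht' (h₁'.trans htu'.symm)]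
          rfl
    · rintro _ (rfl | rfl)
      exacts [hlay.mem_arrows hab (by decide) hs ht hst, hlay.mem_arrows hab (by decide) hs' ht' hst']
  refine sameParity_of_outerArrows (hKa.trans (union_empty _).symm) hLa finite_empty
    (toFinite _) fun hfin => ?_
  rw [union_empty]
  refine (ncard_patternSets_pair hfin (hab.comp ord).lt_add_one (hab.comp ord).eq_of_mem_arc
    (fun p hp k => hp.2 (ord k)) (fun e => ?_) ⟨⟨s, hs, rfl⟩, t, ht, rfl⟩
    ⟨⟨s', hs', rfl⟩, t', ht', rfl⟩).symm
  have := (hab _ _ s hs s' hs' (sameParam_iff.mpr (congrArg Prod.fst e))).2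
  rw [this, hsu'] at hsu
  norm_num at hsu

/-! ### The third move -/

/-- Three simple strands in the disk, any two of which cross exactly once. -/
def IsTriangle (m : Fin 3 → ℝ → Plane) : Prop :=
  InDisk m ∧ (∀ i, ∀ u v, m i u = m i v → u = v) ∧
    ∀ i j, i ≠ j → ∃ u ∈ Icc (-1 : ℝ) 1, ∃ v ∈ Icc (-1 : ℝ) 1, m i u = m j v ∧
      ∀ u' ∈ Icc (-1 : ℝ) 1, ∀ v' ∈ Icc (-1 : ℝ) 1, m i u' = m j v' → u' = u ∧ v' = v

theorem IsTriangle.of_lt {m : Fin 3 → ℝ → Plane} (h₁ : InDisk m)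
    (h₂ : ∀ i, ∀ u v, m i u = m i v → u = v)
    (h₃ : ∀ i j, i < j → ∃ u ∈ Icc (-1 : ℝ) 1, ∃ v ∈ Icc (-1 : ℝ) 1, m i u = m j v ∧
      ∀ u' ∈ Icc (-1 : ℝ) 1, ∀ v' ∈ Icc (-1 : ℝ) 1, m i u' = m j v' → u' = u ∧ v' = v) :
    IsTriangle m := by
  refine ⟨h₁, h₂, fun i j hij => ?_⟩
  rcases hij.lt_or_gt with h | h
  · exact h₃ i j h
  · obtain ⟨u, hu, v, hv, e, h'⟩ := h₃ j i h
    exact ⟨v, hv, u, hu, e.symm, fun v' hv' u' hu' e' => (h' u' hu' v' hv' e'.symm).symm⟩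

theorem isTriangle_omega3Upper : IsTriangle omega3Upper := by
  refine IsTriangle.of_lt (fun i u hu => ?_) (fun i u v h => ?_) fun i j hij => ?_
  · have h : u ^ 2 ≤ 1 := by nlinarith [hu.1, hu.2]
    fin_cases i <;> simp only [unitDisk, omega3Upper, mem_ofPred_eq] <;> simp <;>
      nlinarith [mul_nonneg (sq_nonneg u) (sub_nonneg.mpr h), sq_nonneg u]
  · have h₁ := congrArg Prod.fst h
    fin_cases i <;> simp [omega3Upper] at h₁ <;> linarith
  · obtain ⟨rfl, rfl⟩ | ⟨rfl, rfl⟩ | ⟨rfl, rfl⟩ :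
        i = 0 ∧ j = 1 ∨ i = 0 ∧ j = 2 ∨ i = 1 ∧ j = 2 := by omega
    · refine ⟨0, by simp, 0, by simp, by simp [omega3Upper], fun u hu v hv h => ?_⟩
      have h₁ : 3 * u / 5 = 3 * v / 5 := congrArg Prod.fst h
      have h₂ : 4 * u / 5 = -(4 * v / 5) := congrArg Prod.snd h
      constructor <;> linarith
    -- Substituting `v = 3u/5` in the second coordinate gives `9u² + 40u - 25 = (9u - 5)(u + 5) =
    -- 0`, whose root `-5` lies outside the parameter range. The other witnesses arise by symmetry.
    · refine ⟨5 / 9, ⟨by norm_num, by norm_num⟩, 1 / 3, ⟨by norm_num, by norm_num⟩,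
        by simp [omega3Upper]; norm_num, fun u hu v hv h => ?_⟩
      have h₁ : 3 * u / 5 = v := congrArg Prod.fst h
      have h₂ : 4 * u / 5 = (1 - v ^ 2) / 2 := congrArg Prod.snd h
      have h₃ : (9 * u - 5) * (u + 5) = 0 := by rw [← h₁] at h₂; nlinarith
      have h₄ := (mul_eq_zero.mp h₃).resolve_right (by linarith [hu.1])
      constructor <;> linarith
    · refine ⟨-5 / 9, ⟨by norm_num, by norm_num⟩, -1 / 3, ⟨by norm_num, by norm_num⟩,
        by simp [omega3Upper]; norm_num, fun u hu v hv h => ?_⟩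
      have h₁ : 3 * u / 5 = v := congrArg Prod.fst h
      have h₂ : -(4 * u / 5) = (1 - v ^ 2) / 2 := congrArg Prod.snd h
      have h₃ : (9 * u + 5) * (u - 5) = 0 := by rw [← h₁] at h₂; nlinarith
      have h₄ := (mul_eq_zero.mp h₃).resolve_right (by linarith [hu.2])
      constructor <;> linarith

theorem isTriangle_omega3Lower : IsTriangle omega3Lower := by
  refine IsTriangle.of_lt (fun i u hu => ?_) (fun i u v h => ?_) fun i j hij => ?_
  · have h : u ^ 2 ≤ 1 := by nlinarith [hu.1, hu.2]
    fin_cases i <;> simp only [unitDisk, omega3Lower, mem_ofPred_eq] <;> simp <;>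
      nlinarith [mul_nonneg (sq_nonneg u) (sub_nonneg.mpr h), sq_nonneg u]
  · have h₁ := congrArg Prod.fst h
    fin_cases i <;> simp [omega3Lower] at h₁ <;> linarith
  · obtain ⟨rfl, rfl⟩ | ⟨rfl, rfl⟩ | ⟨rfl, rfl⟩ :
        i = 0 ∧ j = 1 ∨ i = 0 ∧ j = 2 ∨ i = 1 ∧ j = 2 := by omega
    · refine ⟨0, by simp, 0, by simp, by simp [omega3Lower], fun u hu v hv h => ?_⟩
      have h₁ : 3 * u / 5 = 3 * v / 5 := congrArg Prod.fst h
      have h₂ : 4 * u / 5 = -(4 * v / 5) := congrArg Prod.snd h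
      constructor <;> linarith
    · refine ⟨-5 / 9, ⟨by norm_num, by norm_num⟩, -1 / 3, ⟨by norm_num, by norm_num⟩,
        by simp [omega3Lower]; norm_num, fun u hu v hv h => ?_⟩
      have h₁ : 3 * u / 5 = v := congrArg Prod.fst h
      have h₂ : 4 * u / 5 = -((1 - v ^ 2) / 2) := congrArg Prod.snd h
      have h₃ : (9 * u + 5) * (u - 5) = 0 := by rw [← h₁] at h₂; nlinarith
      have h₄ := (mul_eq_zero.mp h₃).resolve_right (by linarith [hu.2])
      constructor <;> linarith
    · refine ⟨5 / 9, ⟨by norm_num, by norm_num⟩, 1 / 3, ⟨by norm_num, by norm_num⟩,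
        by simp [omega3Lower]; norm_num, fun u hu v hv h => ?_⟩
      have h₁ : 3 * u / 5 = v := congrArg Prod.fst h
      have h₂ : -(4 * u / 5) = -((1 - v ^ 2) / 2) := congrArg Prod.snd h
      have h₃ : (9 * u - 5) * (u + 5) = 0 := by rw [← h₁] at h₂; nlinarith
      have h₄ := (mul_eq_zero.mp h₃).resolve_right (by linarith [hu.1])
      constructor <;> linarith

/-- The layering orients the three crossings: `![0, 0, 1]` and `![1, 2, 2]` list the layers of the
starts and ends of the arrows top to middle, top to bottom and middle to bottom. This holds on both
sides of the move. -/
theorem IsTriangle.exists_arrows {m : Fin 3 → ℝ → Plane} (hm : IsTriangle m) {K : KnotDiagram}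
    {φ : Plane → Plane} {a b : Fin 3 → ℝ} {ord : Equiv.Perm (Fin 3)} (hab : ArcsDisjoint a b)
    (hφ : InjOn φ unitDisk) (hK : HasPart K φ m a b) (hlay : Layered K ord a b) :
    ∃ e : Fin 3 → UnitAddCircle × UnitAddCircle, arrows K = outerArrows K a b ∪ range e ∧
      ∀ k, (e k).1 ∈ arc ((a ∘ ord) (![0, 0, 1] k)) ((b ∘ ord) (![0, 0, 1] k)) ∧
        (e k).2 ∈ arc ((a ∘ ord) (![1, 2, 2] k)) ((b ∘ ord) (![1, 2, 2] k)) := by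
  obtain ⟨u, hu₁, hu₂, hu₃, hu₄⟩ := hK.exists_param hφ hm.1
  have hex (p q : Fin 3) (hpq : p < q) : ∃ s ∈ Icc (a (ord p)) (b (ord p)),
      ∃ t ∈ Icc (a (ord q)) (b (ord q)), K.γ s = K.γ t ∧ ∀ s' ∈ Icc (a (ord p)) (b (ord p)),
      ∀ t' ∈ Icc (a (ord q)) (b (ord q)), K.γ s' = K.γ t' → s' = s ∧ t' = t := by
    obtain ⟨x, hx, y, hy, hxy, honly⟩ := hm.2.2 _ _ fun e => hpq.ne (ord.injective e)
    obtain ⟨s, hs, rfl⟩ := hu₃ (ord p) x hx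
    obtain ⟨t, ht, rfl⟩ := hu₃ (ord q) y hy
    refine ⟨s, hs, t, ht, (hu₄ _ _ s hs t ht).mpr hxy, fun s' hs' t' ht' h => ?_⟩
    obtain ⟨h₁, h₂⟩ := honly _ (hu₂ _ s' hs') _ (hu₂ _ t' ht') ((hu₄ _ _ s' hs' t' ht').mp h)
    exact ⟨hu₁ _ hs' hs h₁, hu₁ _ ht' ht h₂⟩
  have hlt : ∀ k : Fin 3, (![0, 0, 1] k : Fin 3) < ![1, 2, 2] k := by decide
  choose s hs t ht hst honly using fun k => hex _ _ (hlt k)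
  refine ⟨fun k => (↑(s k), ↑(t k)), ?_, fun k => ⟨⟨_, hs k, rfl⟩, _, ht k, rfl⟩⟩
  refine Subset.antisymm (fun p hp => ?_) (union_subset (fun p hp => hp.1) ?_)
  · refine (hK.mem_arrows hm.1 hp).imp_right ?_
    rintro ⟨i, j, x, hx, y, hy, rfl⟩
    obtain ⟨i, rfl⟩ := ord.surjective i
    obtain ⟨j, rfl⟩ := ord.surjective j
    obtain ⟨h₁, h₂, -⟩ := coe_mem_arrows.mp hp
    rcases (hlay.lt_of_mem_arrows hx hy hp).eq_or_lt with rfl | hij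
    · exact absurd (congrArg _ (hu₁ _ hx hy (hm.2.1 _ _ _ ((hu₄ _ _ x hx y hy).mp h₁)))) h₂
    · have hk : ∀ i j : Fin 3, i < j → ∃ k : Fin 3, ![0, 0, 1] k = i ∧ ![1, 2, 2] k = j := by
        decide
      obtain ⟨k, rfl, rfl⟩ := hk i j hij
      obtain ⟨rfl, rfl⟩ := honly k x hx y hy h₁
      exact ⟨k, rfl⟩
  · rintro _ ⟨k, rfl⟩
    exact hlay.mem_arrows hab (hlt k) (hs k) (ht k) (hst k)

theorem Replaces.sameParity_omega3 {K L : KnotDiagram} {ord : Equiv.Perm (Fin 3)}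
    {a b : Fin 3 → ℝ} (hcyc : InCyclicOrder (a (ord 0)) (a (ord 1)) (a (ord 2)))
    (h : Replaces omega3Upper omega3Lower ord a b K L) : SameParity K L := by
  have hout := h.outerArrows_eq
  obtain ⟨hab, φ, ψ, hφ, hψ, -, -, hK, hL, hlayK, hlayL, -⟩ := h
  obtain ⟨e, heK, he⟩ := isTriangle_omega3Upper.exists_arrows hab hφ.2.1 hK hlayK
  obtain ⟨e', heL, he'⟩ := isTriangle_omega3Lower.exists_arrows hab hψ.2.1 hL hlayL
  rw [← hout] at heL
  refine sameParity_of_outerArrows heK heL (finite_range _) (finite_range _) fun hfin => ?_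
  have hab' := hab.comp ord
  rw [ncard_patternSets_triangle hfin hab'.lt_add_one hab'.eq_of_mem_arc
    (fun p hp k => hp.2 (ord k)) ?_ he he']
  rintro t m b' ⟨t', ht, et⟩ ⟨m', hm, em⟩ ⟨b'', hb, eb⟩
  -- The cyclic order is given for the left ends of the arcs and is carried to arbitrary points of
  -- them.
  refine (hcyc.of_arcs (t := ![t', m', b'']) hab' (s := a ∘ ord) (i := 0) (j := 1) (k := 2)
    (fun i => ⟨le_rfl, hK.le _⟩) (fun i => ?_) (by decide) (by decide) (by decide)).congr et em eb
  fin_cases i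
  exacts [ht, hm, hb]

theorem Omega1.sameParity {K L : KnotDiagram} (h : Omega1 K L) : SameParity K L :=
  Move.sameParity (fun _ _ _ _ _ _ h => h.sameParity_omega1) h

theorem Omega2.sameParity {K L : KnotDiagram} (h : Omega2 K L) : SameParity K L :=
  Move.sameParity (fun _ _ _ _ _ _ h => h.sameParity_omega2) h

theorem Omega3Descending.sameParity {K L : KnotDiagram} (h : Omega3Descending K L) :
    SameParity K L :=
  Move.sameParity (fun _ _ _ _ _ hP h => h.sameParity_omega3 hP) h

/-! ### Inverse diagrams -/

theorem IsCircleDiffeo.neg_comp_neg {σ : ℝ → ℝ} (hσ : IsCircleDiffeo σ) :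
    IsCircleDiffeo fun t => -σ (-t) := by
  refine ⟨(hσ.1.comp contDiff_neg).neg, fun t => ?_, fun t => ?_⟩
  · have := hσ.2.1 (-(t + 1))
    rw [show -(t + 1) + 1 = -t by ring] at this
    linarith
  · have h : deriv (fun t => -σ (-t)) t = deriv σ (-t) := by
      rw [deriv.fun_neg, deriv_comp_neg, neg_neg]
    rw [h]
    exact hσ.2.2 _

theorem KnotDiagram.Equivalent.inverse {K L : KnotDiagram} (h : K.Equivalent L) :
    K.inverse.Equivalent L.inverse := by
  obtain ⟨F, hF, σ, hσ, h⟩ := h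
  refine ⟨F, hF, _, hσ.neg_comp_neg, fun t => ?_⟩
  simpa [KnotDiagram.inverse] using h (-t)

theorem KnotDiagram.Same.inverse {K L : KnotDiagram} (h : K.Same L) :
    K.inverse.Same L.inverse := by
  obtain ⟨σ, hσ, h⟩ := h
  refine ⟨_, hσ.neg_comp_neg, fun t => ?_⟩
  simpa [KnotDiagram.inverse] using h (-t)

section Inverse

variable {n : ℕ} {a b : Fin n → ℝ}

theorem neg_mem_Icc_iff {s α β : ℝ} : s ∈ Icc (-β) (-α) ↔ -s ∈ Icc α β := by
  simp only [mem_Icc]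
  constructor <;> rintro ⟨h₁, h₂⟩ <;> constructor <;> linarith

theorem sameParam_neg {s t : ℝ} : SameParam (-s) (-t) ↔ SameParam s t := by
  rw [sameParam_iff, sameParam_iff, AddCircle.coe_neg, AddCircle.coe_neg, neg_inj]

theorem ArcsDisjoint.neg (h : ArcsDisjoint a b) : ArcsDisjoint (-b) (-a) := by
  intro i j s hs t ht e
  have := h i j (-s) (neg_mem_Icc_iff.mp hs) (-t) (neg_mem_Icc_iff.mp ht) (sameParam_neg.mpr e)
  exact ⟨this.1, neg_injective this.2⟩

theorem InArcs.neg {t : ℝ} (h : InArcs a b (-t)) : InArcs (-b) (-a) t := by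
  obtain ⟨i, s, hs, e⟩ := h
  exact ⟨i, -s, neg_mem_Icc_iff.mpr (by rwa [neg_neg]), sameParam_neg.mp (by rwa [neg_neg])⟩

theorem HasPart.inverse {K : KnotDiagram} {φ : Plane → Plane} {m : Fin n → ℝ → Plane}
    (h : HasPart K φ m a b) : HasPart K.inverse φ m (-b) (-a) := by
  refine ⟨fun i => ?_, fun t ht => h.2 (-t) fun h' => ht h'.neg⟩
  obtain ⟨u, hu₁, hu₂, hu₃⟩ := h.1 i
  refine ⟨fun t => u (-t), ?_, ?_, fun t ht => hu₃ (-t) (neg_mem_Icc_iff.mp ht)⟩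
  -- Reversal exchanges increasing and decreasing parameters.
  · refine hu₁.symm.imp (fun hu s hs t ht hst => ?_) (fun hu s hs t ht hst => ?_)
    · exact hu (neg_mem_Icc_iff.mp ht) (neg_mem_Icc_iff.mp hs) (neg_lt_neg hst)
    · exact hu (neg_mem_Icc_iff.mp ht) (neg_mem_Icc_iff.mp hs) (neg_lt_neg hst)
  · rw [← hu₂]
    ext v
    constructor
    · rintro ⟨t, ht, rfl⟩
      exact ⟨-t, neg_mem_Icc_iff.mp ht, rfl⟩
    · rintro ⟨t, ht, rfl⟩
      exact ⟨-t, neg_mem_Icc_iff.mpr (by rwa [neg_neg]), by simp⟩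

theorem Layered.inverse {K : KnotDiagram} {ord : Equiv.Perm (Fin n)} (h : Layered K ord a b) :
    Layered K.inverse ord (-b) (-a) := fun p q hpq s hs t ht e =>
  h p q hpq (-s) (neg_mem_Icc_iff.mp hs) (-t) (neg_mem_Icc_iff.mp ht) e

theorem Replaces.inverse {m m' : Fin n → ℝ → Plane} {ord : Equiv.Perm (Fin n)}
    {K L : KnotDiagram} (h : Replaces m m' ord a b K L) :
    Replaces m m' ord (-b) (-a) K.inverse L.inverse := by
  obtain ⟨hab, φ, ψ, hφ, hψ, h₁, h₂, hK, hL, hlayK, hlayL, h⟩ := h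
  exact ⟨hab.neg, φ, ψ, hφ, hψ, h₁, h₂, hK.inverse, hL.inverse, hlayK.inverse, hlayL.inverse,
    fun t ht => h (-t) fun h' => ht h'.neg⟩

theorem Replaces.le {m m' : Fin n → ℝ → Plane} {ord : Equiv.Perm (Fin n)}
    {K L : KnotDiagram} (h : Replaces m m' ord a b K L) (i : Fin n) : a i ≤ b i := by
  obtain ⟨-, φ, ψ, -, -, -, -, hK, -⟩ := h
  exact hK.le i

/-- The arc `[a i, b i]` becomes `[-b i, -a i]`, so the condition on left ends is now tested at
`-b`. Two predicates are allowed because ascending turns into descending. -/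
theorem Move.inverse {m m' : Fin n → ℝ → Plane}
    {P Q : Equiv.Perm (Fin n) → (Fin n → ℝ) → Prop}
    (hPQ : ∀ ord (a b : Fin n → ℝ), ArcsDisjoint a b → (∀ i, a i ≤ b i) → P ord a → Q ord (-b))
    {K L : KnotDiagram} (h : Move m m' P K L) : Move m m' Q K.inverse L.inverse := by
  obtain ⟨K', L', hK, hL, ord, a, b, hP, hr⟩ := h
  refine ⟨_, _, hK.inverse, hL.inverse, ord, -b, -a, ?_, hr.imp Replaces.inverse Replaces.inverse⟩
  rcases hr with hr | hr <;> exact hPQ ord a b hr.1 hr.le hP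

end Inverse

/-- Ascending means the order top, bottom, middle for the left ends; `InCyclicOrder.of_arcs` gives
it for the right ends, whose negatives are the left ends of the reversed arcs in the opposite order.
-/
theorem Omega3Ascending.inverse {K L : KnotDiagram} (h : Omega3Ascending K L) :
    Omega3Descending K.inverse L.inverse := by
  refine Move.inverse (fun ord a b hab hle hP => ?_) h
  have hmem (i : Fin 3) : a i ∈ Icc (a i) (b i) := ⟨le_rfl, hle i⟩
  have hne {i j : Fin 3} (hij : i ≠ j) : (a (ord i) : UnitAddCircle) ≠ a (ord j) := fun e =>
    hij (ord.injective (hab _ _ _ (hmem _) _ (hmem _) (sameParam_iff.mpr e)).1)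
  have h := InCyclicOrder.of_not (hne (by decide)) (hne (by decide)) (hne (by decide)) hP
  exact (InCyclicOrder.of_arcs (hab.comp ord) (s := a ∘ ord) (t := b ∘ ord) (i := 0) (j := 2)
    (k := 1) (fun i => hmem _) (fun i => ⟨hle _, le_rfl⟩) (by decide) (by decide) (by decide) h).neg

theorem Step.sameParity {k : StepKind} (hk : k ≠ .omega3Ascending) {K L : KnotDiagram}
    (h : Step k K L) : SameParity K L := by
  cases k
  · exact KnotDiagram.Equivalent.sameParity h
  · exact Omega1.sameParity h
  · exact Omega2.sameParity h
  · exact absurd rfl hk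
  · exact Omega3Descending.sameParity h

theorem Step.sameParity_inverse {k : StepKind} (hk : k ≠ .omega3Descending) {K L : KnotDiagram}
    (h : Step k K L) : SameParity K.inverse L.inverse := by
  cases k
  · exact (KnotDiagram.Equivalent.inverse h).sameParity
  · exact Omega1.sameParity (Move.inverse (fun _ _ _ _ _ _ => trivial) h)
  · exact Omega2.sameParity (Move.inverse (fun _ _ _ _ _ _ => trivial) h)
  · exact (Omega3Ascending.inverse h).sameParity
  · exact absurd rfl hk

/-! ### The figure eight knot diagram -/

/-- The other passage through the crossing that is passed at the `i`-th place. -/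
def partner : Fin 8 → Fin 8 := ![3, 6, 5, 0, 7, 2, 1, 4]

/-- The parameters `t 0, …, t 7` are the successive passages of the diagram through the crossings
of the figure eight knot. -/
structure IsFigureEightAt (K : KnotDiagram) (t : Fin 8 → ℝ) : Prop where
  chain : IsCyclicChain t
  γ_partner : ∀ i, K.γ (t i) = K.γ (t (partner i))
  all : ∀ r s, Crosses K.γ r s → ∃ i, SameParam (t i) r

theorem KnotDiagram.IsFigureEight.exists_isFigureEightAt {K : KnotDiagram} (h : K.IsFigureEight) :
    ∃ t, IsFigureEightAt K t ∧
      ((∀ i, t i ∈ K.overpass ↔ Even (i : ℕ)) ∨ ∀ i, t i ∈ K.overpass ↔ Odd (i : ℕ)) := by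
  obtain ⟨t, ht, ht', h₁, h₂, h₃, h₄, hall, hover⟩ := h
  refine ⟨t, ⟨⟨ht, ht'⟩, fun i => ?_, hall⟩, hover⟩
  fin_cases i
  exacts [h₁, h₂, h₃, h₁.symm, h₄, h₃.symm, h₂.symm, h₄.symm]

/-- Read backwards, `1 2 3 1 4 3 2 4` is the same sequence with 1 and 4 exchanged, so `partner`
commutes with `Fin.rev`. -/
theorem IsFigureEightAt.inverse {K : KnotDiagram} {t : Fin 8 → ℝ} (h : IsFigureEightAt K t) :
    IsFigureEightAt K.inverse fun i => -t i.rev := by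
  refine ⟨⟨fun i j hij => neg_lt_neg (h.chain.1 (Fin.rev_lt_rev.mpr hij)), ?_⟩, fun i => ?_,
    fun r s hrs => ?_⟩
  · have := h.chain.2
    change -t 0 < -t 7 + 1
    linarith
  · have hrev : ∀ i : Fin 8, (partner i).rev = partner i.rev := by decide
    simp only [KnotDiagram.inverse, neg_neg, hrev]
    exact h.γ_partner _
  · obtain ⟨i, hi⟩ := h.all _ _ (KnotDiagram.crosses_neg.mp hrs)
    exact ⟨i.rev, by simpa using sameParam_neg.mpr hi⟩

theorem IsFigureEightAt.arrows_eq {K : KnotDiagram} {t : Fin 8 → ℝ} (h : IsFigureEightAt K t) :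
    arrows K = {p | ∃ i, t i ∈ K.overpass ∧ p = (↑(t i), ↑(t (partner i)))} := by
  have hne {i j : Fin 8} (hij : i ≠ j) : ¬ SameParam (t i) (t j) := fun e =>
    hij (h.chain.coe_injective (sameParam_iff.mp e))
  have hp : ∀ i : Fin 8, i ≠ partner i := by decide
  ext p
  constructor
  · rintro ⟨r, s, hrs, ho, rfl⟩
    obtain ⟨i, hi⟩ := h.all r s hrs
    obtain ⟨j, hj⟩ := h.all s r ⟨hrs.1.symm, fun e => hrs.2 (sameParam_iff.mpr
      (sameParam_iff.mp e).symm)⟩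
    rw [sameParam_iff] at hi hj
    have hij : i ≠ j := by
      rintro rfl
      exact hrs.2 (sameParam_iff.mpr (hi.symm.trans hj))
    have hγ : K.γ (t i) = K.γ (t j) := by
      rw [K.γ_eq_of_coe_eq hi, K.γ_eq_of_coe_eq hj, hrs.1]
    -- A second passage other than the partner would make a triple point.
    obtain rfl : j = partner i := by
      by_contra hj'
      exact K.no_triple _ _ _ ⟨(h.γ_partner i).symm, hne (hp i).symm⟩ ⟨hγ, hne hij⟩
        ⟨(h.γ_partner i).symm.trans hγ, hne (Ne.symm hj')⟩
    exact ⟨i, (K.mem_overpass_of_coe_eq hi).mpr ho, by rw [hi, hj]⟩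
  · rintro ⟨i, ho, rfl⟩
    exact ⟨_, _, ⟨h.γ_partner i, hne (hp i)⟩, ho, rfl⟩

theorem IsFigureEightAt.finite_arrows {K : KnotDiagram} {t : Fin 8 → ℝ}
    (h : IsFigureEightAt K t) : (arrows K).Finite := by
  rw [h.arrows_eq]
  refine (finite_range fun i => ((t i : UnitAddCircle), (t (partner i) : UnitAddCircle))).subset ?_
  rintro _ ⟨i, -, rfl⟩
  exact ⟨i, rfl⟩

/-- The arrows run from the odd places `i` to `i + 5` modulo 8: they are the pattern shifted by one
place. -/
theorem IsFigureEightAt.ncard_of_odd {K : KnotDiagram} {t : Fin 8 → ℝ}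
    (h : IsFigureEightAt K t) (hodd : ∀ i, t i ∈ K.overpass ↔ Odd (i : ℕ)) :
    (patternSets (arrows K)).ncard = 1 := by
  set c : Fin 4 → UnitAddCircle × UnitAddCircle :=
    fun i => (↑(t (overIndex i + 1)), ↑(t (underIndex i + 1)))
  have hc : IsPattern c := by
    -- The chain is rotated by one place so as to begin with an overpass; hence the last entry is `t
    -- 0` one turn later.
    refine ⟨![t 1, t 2, t 3, t 4, t 5, t 6, t 7, t 0 + 1], ⟨?_, ?_⟩, fun i => ?_⟩
    · rw [Fin.strictMono_iff_lt_succ]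
      intro i
      fin_cases i
      exacts [h.chain.1 (by decide), h.chain.1 (by decide), h.chain.1 (by decide),
        h.chain.1 (by decide), h.chain.1 (by decide), h.chain.1 (by decide), h.chain.2]
    · have : t 0 < t 1 := h.chain.1 (by decide)
      change t 0 + 1 < t 1 + 1
      linarith
    · have h01 : ((t 0 + 1 : ℝ) : UnitAddCircle) = t 0 :=
        (sameParam_iff.mp ⟨1, by simp⟩).symm
      fin_cases i
      · rfl
      · exact Prod.ext rfl h01.symm
      · rfl
      · rfl
  have hrange : arrows K = range c := by
    have key : ∀ i : Fin 8, Odd (i : ℕ) → ∃ k, overIndex k + 1 = i ∧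
        underIndex k + 1 = partner i := by decide
    have key' : ∀ k, Odd ((overIndex k + 1 : Fin 8) : ℕ) ∧
        partner (overIndex k + 1) = underIndex k + 1 := by decide
    rw [h.arrows_eq]
    ext p
    constructor
    · rintro ⟨i, hi, rfl⟩
      obtain ⟨k, hk, hk'⟩ := key i ((hodd i).mp hi)
      exact ⟨k, by simp only [c, hk, hk']⟩
    · rintro ⟨k, rfl⟩
      exact ⟨_, (hodd _).mpr (key' k).1, by rw [(key' k).2]⟩
  rw [ncard_eq_one]
  refine ⟨range c, Subset.antisymm ?_ ?_⟩
  · rintro _ ⟨hS, c', hc', rfl⟩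
    rw [hrange] at hS
    -- A pattern has four distinct arrows, and the diagram has no more than four.
    refine eq_of_subset_of_ncard_le hS ?_ (finite_range c)
    rw [ncard_range_of_injective hc.injective, ncard_range_of_injective hc'.injective]
  · rintro _ rfl
    exact ⟨hrange.symm.subset, c, hc, rfl⟩

/-- The arrows now run from the even places `i` to `i + 3` modulo 8, so only one overpass lies
between start and end of an arrow. In the pattern arrow 0 runs from place 0 to place 5 and passes
the starts of both arrow 1 and arrow 2. -/
theorem IsFigureEightAt.ncard_of_even {K : KnotDiagram} {t : Fin 8 → ℝ}
    (h : IsFigureEightAt K t) (heven : ∀ i, t i ∈ K.overpass ↔ Even (i : ℕ)) :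
    (patternSets (arrows K)).ncard = 0 := by
  suffices hempty : patternSets (arrows K) = ∅ by rw [hempty, ncard_empty]
  refine eq_empty_of_forall_notMem ?_
  rintro _ ⟨hS, c, hc, rfl⟩
  have hS' (k : Fin 4) : ∃ i : Fin 8, Even (i : ℕ) ∧ c k = (↑(t i), ↑(t (partner i))) := by
    have hk : c k ∈ arrows K := hS ⟨k, rfl⟩
    rw [h.arrows_eq] at hk
    obtain ⟨i, hi, e⟩ := hk
    exact ⟨i, (heven i).mp hi, e⟩
  obtain ⟨i, hi, ei⟩ := hS' 0
  obtain ⟨j, hj, ej⟩ := hS' 1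
  obtain ⟨k, hk, ek⟩ := hS' 2
  have hne : c 1 ≠ c 2 := fun e => absurd (hc.injective e) (by decide)
  obtain ⟨x, hx, hcx⟩ := hc
  have h0 := ei.symm.trans (hcx 0)
  have h1 := ej.symm.trans (hcx 1)
  have h2 := ek.symm.trans (hcx 2)
  have c1 := h.chain.indexCyclic ((hx.inCyclicOrder (i := 0) (j := 2) (k := 5) (by decide)).congr
    (congrArg Prod.fst h0).symm (congrArg Prod.fst h1).symm (congrArg Prod.snd h0).symm)
  have c2 := h.chain.indexCyclic ((hx.inCyclicOrder (i := 0) (j := 4) (k := 5) (by decide)).congr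
    (congrArg Prod.fst h0).symm (congrArg Prod.fst h2).symm (congrArg Prod.snd h0).symm)
  have key : ∀ i j k : Fin 8, Even (i : ℕ) → Even (j : ℕ) → Even (k : ℕ) →
      IndexCyclic i j (partner i) → IndexCyclic i k (partner i) → j = k := by decide
  obtain rfl := key i j k hi hj hk c1 c2
  exact hne (ej.trans ek.symm)

/-- Counting places backwards exchanges even and odd, so of `K` and its inverse one has exactly one
pattern and the other none. -/
theorem IsFigureEightAt.not_sameParity {K : KnotDiagram} {t : Fin 8 → ℝ}
    (h : IsFigureEightAt K t)
    (ht : (∀ i, t i ∈ K.overpass ↔ Even (i : ℕ)) ∨ ∀ i, t i ∈ K.overpass ↔ Odd (i : ℕ)) :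
    ¬ SameParity K K.inverse := by
  intro hs
  have hmod := hs.2 h.finite_arrows
  have hover (i : Fin 8) : -t i.rev ∈ K.inverse.overpass ↔ t i.rev ∈ K.overpass := by
    simp [KnotDiagram.inverse]
  rcases ht with ht | ht
  · rw [h.ncard_of_even ht, h.inverse.ncard_of_odd fun i => ?_] at hmod
    · exact absurd hmod (by decide)
    · rw [hover, ht]
      revert i
      decide
  · rw [h.ncard_of_odd ht, h.inverse.ncard_of_even fun i => ?_] at hmod
    · exact absurd hmod (by decide)
    · rw [hover, ht]
      revert i
      decide

theorem KnotDiagram.inverse_inverse (K : KnotDiagram) : K.inverse.inverse = K := by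
  cases K
  simp [KnotDiagram.inverse]

end PlaneKnot

/-! ### The theorem -/

theorem theorem1 (K : PlaneKnot.KnotDiagram) (hK : K.IsFigureEight) (n : ℕ)
    (D : Fin (n + 1) → PlaneKnot.KnotDiagram) (kind : Fin n → PlaneKnot.StepKind)
    (hfirst : D 0 = K) (hlast : D (Fin.last n) = K.inverse)
    (hD : PlaneKnot.IsTransformation D kind) :
    (∃ i, kind i = PlaneKnot.StepKind.omega3Ascending) ∧
    (∃ i, kind i = PlaneKnot.StepKind.omega3Descending) ∧
    2 ≤ {i | kind i = PlaneKnot.StepKind.omega3Ascending ∨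
      kind i = PlaneKnot.StepKind.omega3Descending}.ncard := by
  obtain ⟨t, ht, hover⟩ := hK.exists_isFigureEightAt
  have hne := ht.not_sameParity hover
  have hasc : ∃ i, kind i = PlaneKnot.StepKind.omega3Ascending := by
    by_contra! h
    have (i : Fin (n + 1)) : PlaneKnot.SameParity (D 0) (D i) := by
      induction i using Fin.induction with
      | zero => exact .refl _
      | succ i ih => exact ih.trans ((hD i).sameParity (h i))
    refine hne ?_
    rw [← hlast, ← hfirst]
    exact this _
  have hdesc : ∃ i, kind i = PlaneKnot.StepKind.omega3Descending := by
    by_contra! h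
    -- The invariant is evaluated on the inverses of all diagrams, for which only descending moves
    -- could change it; the sequence of inverses leads from `K.inverse` back to `K`.
    have (i : Fin (n + 1)) : PlaneKnot.SameParity (D 0).inverse (D i).inverse := by
      induction i using Fin.induction with
      | zero => exact .refl _
      | succ i ih => exact ih.trans ((hD i).sameParity_inverse (h i))
    refine hne ?_
    have h' := this (Fin.last n)
    rw [hlast, hfirst, K.inverse_inverse] at h'
    exact h'.symm
  refine ⟨hasc, hdesc, ?_⟩
  obtain ⟨i, hi⟩ := hasc
  obtain ⟨j, hj⟩ := hdesc
  have hij : i ≠ j := by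
    rintro rfl
    rw [hi] at hj
    cases hj
  rw [← Set.ncard_pair hij]
  refine Set.ncard_le_ncard ?_ (Set.toFinite _)
  rintro _ (rfl | rfl)
  exacts [Or.inl hi, Or.inr hj]
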